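/- Let $\{p_k\}_{k\ge 0}$ be an offspring distribution with $p_0=0<p_1<1$ and $\sum_k p_k e^{\theta k}<\infty$ for some $\theta>0$, and let $X$ be a real random variable whose law is symmetric, with $E[X^2]=1$. Consider the branching random walk started from one particle at $0$ in which the genealogical tree is a Galton–Watson tree with offspring distribution $\{p_k\}$ and, given the tree, the displacements of the non-root individuals from their parents are i.i.d. copies of $X$. Let $Z_n(B)$ be the number of individuals of generation $n$ located in $B\subset\mathbb{R}$, and $\bar Z_n(B)=Z_n(B)/Z_n(\mathbb{R})$. Let $\nu$ be the standard Gaussian measure on $\mathbb{R}$, let $A\neq\emptyset$ belong to the algebra of subsets of $\mathbb{R}$ generated by $\{(-\infty,x]:x\in\mathbb{R}\}$, with $\nu(A)>0$, and for $p\in(\nu(A),1)$ put $$I_A(p)=\inf\{|x|:\nu(A-x)\ge p\}\quad(\inf\emptyset=\infty),\qquad J_A(p)=\inf\Big\{y\in[0,1]:\ \sup_{x\in\mathbb{R}}\nu\Big(\frac{A-x}{\sqrt{1-y}}\Big)\ge p\Big\}.$$ If $p\in(\nu(A),1)$ is such that $I_A(p)=\infty$ and the function $J_A$ is continuous at $p$,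 then $$\lim_{n\to\infty}\frac1n\log \mathbb{P}\big(\bar Z_n(\sqrt n\,A)\ge p\big)=(\log p_1)\,J_A(p).$$ -/

import Mathlib

open MeasureTheory ProbabilityTheory Filter Topology
open scoped Pointwise ENNReal

noncomputable section

/-- The standard Gaussian measure `ν` on `ℝ`. -/
def normalNu : Measure ℝ := gaussianReal 0 1

/-- The algebra of subsets of `ℝ` generated by the half-lines `(-∞, x]`. -/
def halfLineAlgebra : Set (Set ℝ) := generateSetAlgebra (Set.range (Set.Iic : ℝ → Set ℝ))

/-- `I_A(p) = inf {|x| : ν(A - x) ≥ p}`, with `inf ∅ = ∞`. -/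
def rateI (A : Set ℝ) (p : ℝ) : ℝ≥0∞ :=
  sInf {r | ∃ x : ℝ, r = ENNReal.ofReal |x| ∧ p ≤ normalNu.real ((fun a => a - x) '' A)}

/-- `J_A(p) = inf {y ∈ [0,1] : sup_x ν((A - x) / √(1 - y)) ≥ p}`. The endpoint `y = 1` plays no
role for nonempty `A` in the algebra and `0 < p < 1`: some `y < 1` always belongs to the set
(and at `y = 1` the image below is the null set `{0}`). -/
def rateJ (A : Set ℝ) (p : ℝ) : ℝ :=
  sInf {y | y ∈ Set.Icc (0 : ℝ) 1 ∧
    p ≤ ⨆ x : ℝ, normalNu.real ((fun a => (a - x) / √(1 - y)) '' A)}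

namespace BRW

/-- Nodes are words of natural numbers, the most recent letter first: the root is `[]`, and
`i :: u` is the child number `i` of `u`. Given the numbers of children `N u`, this says that
a word belongs to the genealogical tree. -/
def InTree (N : List ℕ → ℕ) : List ℕ → Prop
  | [] => True
  | i :: u => InTree N u ∧ i < N u

/-- The position `S_v`, the sum of the steps `X_u` over the ancestors `u ≠ []` of `v`,
`v` included. The value of `X` at the root is not used. -/
def position (X : List ℕ → ℝ) : List ℕ → ℝ
  | [] => 0
  | i :: u => position X u + X (i :: u)

/-- The nodes of generation `n`. -/
def generation (N : List ℕ → ℕ) (n : ℕ) : Set (List ℕ) := {v | v.length = n ∧ InTree N v}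

/-- Every generation is finite, so that the cardinality in `count` is a genuine one. -/
theorem generation_finite (N : List ℕ → ℕ) (n : ℕ) : (generation N n).Finite := by
  induction n with
  | zero =>
    refine (Set.finite_singleton ([] : List ℕ)).subset ?_
    rintro v ⟨hv, -⟩
    exact List.length_eq_zero_iff.mp hv
  | succ n ih =>
    refine (ih.biUnion (fun u _ => (Set.finite_Iio (N u)).image (fun i => i :: u))).subset ?_
    rintro v ⟨hv, ht⟩
    cases v with
    | nil => simp at hv
    | cons i u =>
      simp only [Set.mem_iUnion]
      exact ⟨u, ⟨by simpa using hv, ht.1⟩, i, ht.2, rfl⟩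

/-- `Z_n(B)`: the number of individuals of generation `n` located in `B`. -/
def count (N : List ℕ → ℕ) (X : List ℕ → ℝ) (n : ℕ) (B : Set ℝ) : ℕ :=
  {v | v ∈ generation N n ∧ position X v ∈ B}.ncard

/-- The empirical distribution `Z_n(B) / Z_n(ℝ)`. -/
def empirical (N : List ℕ → ℕ) (X : List ℕ → ℝ) (n : ℕ) (B : Set ℝ) : ℝ :=
  (count N X n B : ℝ) / (count N X n Set.univ : ℝ)

/-- The families `N` (numbers of children) and `X` (steps) on `(Ω, P)` drive a branching random
walk with offspring distribution `q` and step distribution `μ`: the `N u` are i.i.d. with law `q`,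
the `X u` are i.i.d. with law `μ`, and the two families are independent of each other. -/
structure IsBRW {Ω : Type*} [MeasurableSpace Ω] (P : Measure Ω) (q : PMF ℕ) (μ : Measure ℝ)
    (N : List ℕ → Ω → ℕ) (X : List ℕ → Ω → ℝ) : Prop where
  measurable_N : ∀ u, Measurable (N u)
  measurable_X : ∀ u, Measurable (X u)
  law_N : ∀ u, P.map (N u) = q.toMeasure
  law_X : ∀ u, P.map (X u) = μ
  indep_N : iIndepFun N P
  indep_X : iIndepFun X P
  indep_N_X : IndepFun (fun ω u => N u ω) (fun ω u => X u ω) P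

end BRW

end

/-! The cheap way to make the empirical measure atypical is not to branch. With probability `p₁ ^ m`
the first `m ≈ y n` generations form a single line, and its particle reaches the neighbourhood of `x
√n` at no exponential cost. The branching random walk that it starts has about `(1 - y) n`
generations left and obeys a law of large numbers: it gives `√n A` a proportion close to `ν((A - x)
/ √(1 - y))`. The least delay that suffices is `J_A(p)`; the condition on `I_A` excludes `y = 0`,
which would leave no time to move.

Both bounds rest on `lintegral_prod_generation_add`: the mean of a product of `f` over generation `m
+ k` is the mean of the product over generation `m` of the `k`-th iterate of `branchingOp` on `f`.
For `f = exp (l (1_{√n A} - p))` the product is at least `1` on the event. With `l = L / M ^ k`,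
where `M > 1` is the mean offspring number, `exists_iterate_branchingOp_exp_le` bounds the iterate
by some `s < 1` independent of `k`, wherever the mean proportion stays below `p` by a fixed margin.

Upper bound (`IsBRW.eventually_le`): if `y < J_A(p')` with `p' < p`, this holds at every starting
point, and the first `m` generations turn `s` into the `m`-th iterate of the generating function,
which decays at any rate above `p₁` because `p₀ = 0`. Lower bound (`IsBRW.eventually_ge`): with the
sign of the exponent reversed, `s` bounds the conditional probability of failure after the line has
reached its target. The margins come from a central limit theorem uniform over affine images of `A`
(`uniform_measure_affine`), and continuity of `J_A` at `p` lets `p'` approach `p` from either side.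
-/

/-! ### Integrating out coordinates of an i.i.d. family. -/

section Resampling

variable {ι E : Type*} [DecidableEq ι] [MeasurableSpace E] (ρ : Measure E) [IsProbabilityMeasure ρ]

/-- Resampling one coordinate of an i.i.d. family leaves its law unchanged. -/
theorem map_update_infinitePi (i : ι) :
    (ρ.prod (Measure.infinitePi fun _ : ι => ρ)).map (fun p => Function.update p.2 i p.1) =
      Measure.infinitePi fun _ : ι => ρ := by
  have hmeas : Measurable (fun p : E × (ι → E) => Function.update p.2 i p.1) := by
    refine measurable_pi_iff.2 fun j => ?_
    by_cases h : j = i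
    · subst h; simpa using measurable_fst
    · simp only [Function.update_of_ne h]; fun_prop
  refine Measure.eq_infinitePi _ fun s t ht => ?_
  have hpre : (fun p : E × (ι → E) => Function.update p.2 i p.1) ⁻¹' (Set.pi s t) =
      (if i ∈ s then t i else Set.univ) ×ˢ (Set.pi (s.erase i) t) := by
    ext ⟨z, x⟩
    simp only [Set.mem_preimage, Set.mem_pi, Set.mem_prod, Finset.mem_coe, Finset.mem_erase]
    constructor
    · intro h
      refine ⟨?_, fun j hj => ?_⟩
      · split_ifs with hi
        · simpa using h i hi
        · trivial
      · simpa [Function.update_of_ne hj.1] using h j hj.2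
    · rintro ⟨h1, h2⟩ j hj
      by_cases h : j = i
      · subst h; simpa [hj] using h1
      · simpa [Function.update_of_ne h] using h2 j ⟨h, hj⟩
  rw [Measure.map_apply hmeas (MeasurableSet.pi (Finset.countable_toSet s) fun j _ => ht j), hpre,
    Measure.prod_prod, Measure.infinitePi_pi _ fun j _ => ht j]
  split_ifs with hi
  · exact Finset.mul_prod_erase s (fun j => ρ (t j)) hi
  · simp [Finset.erase_eq_of_notMem hi]

theorem lintegral_infinitePi_update (i : ι) {Φ : (ι → E) → ℝ≥0∞} (hΦ : Measurable Φ) :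
    ∫⁻ x, Φ x ∂(Measure.infinitePi fun _ : ι => ρ) =
      ∫⁻ x, ∫⁻ z, Φ (Function.update x i z) ∂ρ ∂(Measure.infinitePi fun _ : ι => ρ) := by
  have hmeas : Measurable (fun p : E × (ι → E) => Function.update p.2 i p.1) := by
    refine measurable_pi_iff.2 fun j => ?_
    by_cases h : j = i
    · subst h; simpa using measurable_fst
    · simp only [Function.update_of_ne h]; fun_prop
  conv_lhs => rw [← map_update_infinitePi ρ i]
  rw [lintegral_map hΦ hmeas]
  exact lintegral_prod_symm _ (hΦ.comp hmeas).aemeasurable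

/-- Integrating out finitely many coordinates of an i.i.d. family, the others being frozen. -/
theorem lintegral_infinitePi_mul_prod (D : Finset ι) {G : (ι → E) → ℝ≥0∞} (hG : Measurable G)
    {h : ι → (ι → E) → E → ℝ≥0∞} (hh : ∀ j, Measurable (Function.uncurry (h j)))
    (hGD : ∀ j ∈ D, ∀ x z, G (Function.update x j z) = G x)
    (hhD : ∀ j ∈ D, ∀ k ∈ D, ∀ x w, h j (Function.update x k w) = h j x) :
    ∫⁻ x, G x * ∏ j ∈ D, h j x (x j) ∂(Measure.infinitePi fun _ : ι => ρ) =
      ∫⁻ x, G x * ∏ j ∈ D, ∫⁻ z, h j x z ∂ρ ∂(Measure.infinitePi fun _ : ι => ρ) := by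
  classical
  have hI : ∀ j, Measurable (fun x => ∫⁻ z, h j x z ∂ρ) := fun j => (hh j).lintegral_prod_right
  have hdiag : ∀ j, Measurable (fun x : ι → E => h j x (x j)) := fun j =>
    (hh j).comp (measurable_id.prodMk (measurable_pi_apply j))
  induction D using Finset.induction_on generalizing G with
  | empty => simp
  | insert i D hi ih =>
    have hGi : ∀ x z, G (Function.update x i z) = G x := hGD i (Finset.mem_insert_self _ _)
    have hDi : ∀ j ∈ D, j ≠ i := fun j hj => fun e => hi (e ▸ hj)
    have hmem : ∀ {j}, j ∈ D → j ∈ insert i D := fun hj => Finset.mem_insert_of_mem hj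
    have hmi := Finset.mem_insert_self i D
    simp_rw [Finset.prod_insert hi]
    -- Coordinate `i` alone is resampled. By `hGD` and `hhD` only the last argument of `h i` sees
    -- the new value; its integral is then absorbed into `G`, over which the induction is
    -- generalized.
    have step : ∫⁻ x, G x * (h i x (x i) * ∏ j ∈ D, h j x (x j))
          ∂(Measure.infinitePi fun _ : ι => ρ) =
        ∫⁻ x, (G x * ∫⁻ z, h i x z ∂ρ) * ∏ j ∈ D, h j x (x j)
          ∂(Measure.infinitePi fun _ : ι => ρ) := by
      rw [lintegral_infinitePi_update ρ i (Φ := fun x => G x * (h i x (x i) * ∏ j ∈ D, h j x (x j)))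
        (hG.mul ((hdiag i).mul (Finset.measurable_fun_prod D fun j _ => hdiag j)))]
      refine lintegral_congr fun x => ?_
      have hrw : ∀ z, G (Function.update x i z) * (h i (Function.update x i z)
          (Function.update x i z i) * ∏ j ∈ D, h j (Function.update x i z)
          (Function.update x i z j)) = (G x * ∏ j ∈ D, h j x (x j)) * h i x z := by
        intro z
        rw [hGi, hhD i hmi i hmi, Function.update_self]
        rw [Finset.prod_congr rfl fun j hj => by
          rw [hhD j (hmem hj) i hmi, Function.update_of_ne (hDi j hj)]]
        ring
      simp_rw [hrw]
      rw [lintegral_const_mul _ (f := fun z => h i x z)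
        ((hh i).comp (measurable_const.prodMk measurable_id))]
      ring
    rw [step, ih (G := fun x => G x * ∫⁻ z, h i x z ∂ρ) (hG.mul (hI i))]
    · refine lintegral_congr fun x => by ring
    · intro j hj x z
      rw [hGD j (hmem hj), hhD i hmi j (hmem hj)]
    · exact fun j hj k hk => hhD j (hmem hj) k (hmem hk)

end Resampling

/-! ### Generations as random finite sets: locality and measurability. -/

namespace BRW

/-- The nodes of generation `n`, as a finset. -/
noncomputable def generationFinset (N : List ℕ → ℕ) (n : ℕ) : Finset (List ℕ) :=
  (generation_finite N n).toFinset

theorem mem_generationFinset {N : List ℕ → ℕ} {n : ℕ} {v : List ℕ} :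
    v ∈ generationFinset N n ↔ v.length = n ∧ InTree N v := by
  simp [generationFinset, generation]

theorem generationFinset_zero (N : List ℕ → ℕ) : generationFinset N 0 = {[]} := by
  ext v
  simp only [mem_generationFinset, List.length_eq_zero_iff, Finset.mem_singleton]
  exact ⟨fun h => h.1, fun h => ⟨h, h ▸ trivial⟩⟩

theorem inTree_congr {N N' : List ℕ → ℕ} {v : List ℕ} (h : ∀ u, u.length < v.length → N u = N' u) :
    InTree N v ↔ InTree N' v := by
  induction v with
  | nil => exact Iff.rfl
  | cons i u ih =>
    simp only [InTree]
    rw [ih fun w hw => h w (hw.trans (by simp)), h u (by simp)]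

theorem generationFinset_congr {N N' : List ℕ → ℕ} {n : ℕ} (h : ∀ u, u.length < n → N u = N' u) :
    generationFinset N n = generationFinset N' n := by
  ext v
  simp only [mem_generationFinset]
  refine and_congr_right fun hv => inTree_congr fun u hu => h u (hv ▸ hu)

theorem position_congr {X X' : List ℕ → ℝ} {v : List ℕ} (h : ∀ u, u.length ≤ v.length → X u = X' u) :
    position X v = position X' v := by
  induction v with
  | nil => rfl
  | cons i u ih =>
    simp only [position]
    rw [ih fun w hw => h w (hw.trans (by simp)), h _ le_rfl]

theorem measurable_position (v : List ℕ) : Measurable fun X : List ℕ → ℝ => position X v := by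
  induction v with
  | nil => exact measurable_const
  | cons i u ih => exact ih.add (measurable_pi_apply _)

theorem measurableSet_inTree (v : List ℕ) : MeasurableSet {N : List ℕ → ℕ | InTree N v} := by
  induction v with
  | nil => exact MeasurableSet.univ
  | cons i u ih =>
    exact ih.inter (measurableSet_lt measurable_const (measurable_pi_apply u))

theorem measurableSet_generationFinset_eq (n : ℕ) (D : Finset (List ℕ)) :
    MeasurableSet {N : List ℕ → ℕ | generationFinset N n = D} := by
  have : {N : List ℕ → ℕ | generationFinset N n = D} =
      ⋂ v : List ℕ, {N | (v.length = n ∧ InTree N v) ↔ v ∈ D} := by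
    ext N
    simp [Finset.ext_iff, mem_generationFinset]
  rw [this]
  refine MeasurableSet.iInter fun v => ?_
  by_cases h1 : v.length = n <;> by_cases h2 : v ∈ D <;> simp only [h1, h2, true_and, false_and,
    iff_true, iff_false, MeasurableSet.const]
  · exact measurableSet_inTree v
  · exact (measurableSet_inTree v).compl

/-- The index set of the product is random but takes countably many values; splitting over them
reduces measurability and integration to products over a fixed finite set. -/
theorem prod_generationFinset_eq_tsum (N : List ℕ → ℕ) (n : ℕ) (a : List ℕ → ℝ≥0∞) :
    ∏ v ∈ generationFinset N n, a v = ∑' D : Finset (List ℕ),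
      {N : List ℕ → ℕ | generationFinset N n = D}.indicator 1 N * ∏ v ∈ D, a v := by
  rw [tsum_eq_single (generationFinset N n)]
  · simp
  · intro D hD
    simp [hD.symm]

theorem measurable_prod_generationFinset (n : ℕ)
    {a : List ℕ → (List ℕ → ℕ) × (List ℕ → ℝ) → ℝ≥0∞} (ha : ∀ v, Measurable (a v)) :
    Measurable fun p : (List ℕ → ℕ) × (List ℕ → ℝ) => ∏ v ∈ generationFinset p.1 n, a v p := by
  simp_rw [prod_generationFinset_eq_tsum]
  refine Measurable.tsum fun D => Measurable.mul ?_ (Finset.measurable_fun_prod _ fun v _ => ha v)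
  exact (measurable_one.indicator (measurableSet_generationFinset_eq n D)).comp measurable_fst

theorem prod_generationFinset_succ (N : List ℕ → ℕ) (n : ℕ) (a : List ℕ → ℝ≥0∞) :
    ∏ v ∈ generationFinset N (n + 1), a v.tail = ∏ u ∈ generationFinset N n, a u ^ N u := by
  have hmap : ∀ v ∈ generationFinset N (n + 1), v.tail ∈ generationFinset N n := by
    intro v hv
    rw [mem_generationFinset] at hv ⊢
    cases v with
    | nil => simp at hv
    | cons i u => exact ⟨by simpa using hv.1, hv.2.1⟩
  rw [← Finset.prod_fiberwise_of_maps_to hmap]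
  refine Finset.prod_congr rfl fun u hu => ?_
  have hfib : (generationFinset N (n + 1)).filter (fun v => v.tail = u) =
      (Finset.range (N u)).image (fun i => i :: u) := by
    ext v
    simp only [Finset.mem_filter, Finset.mem_image, Finset.mem_range]
    rw [mem_generationFinset] at hu ⊢
    constructor
    · rintro ⟨⟨hv1, hv2⟩, hv3⟩
      cases v with
      | nil => simp at hv1
      | cons i w =>
        simp only [List.tail_cons] at hv3
        subst hv3
        exact ⟨i, hv2.2, rfl⟩
    · rintro ⟨i, hi, rfl⟩
      exact ⟨⟨by simp [hu.1], hu.2, hi⟩, rfl⟩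
  rw [Finset.prod_congr rfl fun v hv => by rw [(Finset.mem_filter.1 hv).2], Finset.prod_const, hfib,
    Finset.card_image_of_injective _ fun i j h => (List.cons.inj h).1, Finset.card_range]

/-- `F` depends only on the first `m` generations: on the numbers of children before generation `m`
and on the steps up to generation `m`. -/
def DependsUpTo (m : ℕ) (F : (List ℕ → ℕ) → (List ℕ → ℝ) → ℝ≥0∞) : Prop :=
  ∀ N N' X X', (∀ u : List ℕ, u.length < m → N u = N' u) →
    (∀ u : List ℕ, u.length ≤ m → X u = X' u) → F N X = F N' X'

theorem DependsUpTo.mono {m n : ℕ} (hmn : m ≤ n) {F : (List ℕ → ℕ) → (List ℕ → ℝ) → ℝ≥0∞}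
    (hF : DependsUpTo m F) : DependsUpTo n F := fun N N' X X' hN hX =>
  hF N N' X X' (fun u hu => hN u (hu.trans_le hmn)) fun u hu => hX u (hu.trans hmn)

/-- The law of a pair of families that drives a branching random walk. -/
noncomputable def canonicalLaw (q : PMF ℕ) (μ : Measure ℝ) [IsProbabilityMeasure μ] :
    Measure ((List ℕ → ℕ) × (List ℕ → ℝ)) :=
  (Measure.infinitePi fun _ : List ℕ => q.toMeasure).prod (Measure.infinitePi fun _ : List ℕ => μ)

instance (q : PMF ℕ) (μ : Measure ℝ) [IsProbabilityMeasure μ] :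
    IsProbabilityMeasure (canonicalLaw q μ) := by
  unfold canonicalLaw; infer_instance

theorem IsBRW.map_eq {Ω : Type*} [MeasurableSpace Ω] {P : Measure Ω} [IsProbabilityMeasure P]
    {q : PMF ℕ} {μ : Measure ℝ} [IsProbabilityMeasure μ] {N : List ℕ → Ω → ℕ} {X : List ℕ → Ω → ℝ}
    (h : IsBRW P q μ N X) :
    P.map (fun ω => ((fun u => N u ω), (fun u => X u ω))) = canonicalLaw q μ := by
  have hN : Measurable fun ω u => N u ω := measurable_pi_iff.2 h.measurable_N
  have hX : Measurable fun ω u => X u ω := measurable_pi_iff.2 h.measurable_X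
  rw [(indepFun_iff_map_prod_eq_prod_map_map hN.aemeasurable hX.aemeasurable).1 h.indep_N_X,
    h.indep_N.map_fun_eq_infinitePi_map h.measurable_N,
    h.indep_X.map_fun_eq_infinitePi_map h.measurable_X]
  simp_rw [h.law_N, h.law_X]
  rfl

/-! ### The branching property for multiplicative functionals. -/

/-- The one-generation operator: `E [∏ f (x + X_i)]` over the children `i` of a node at `x`. -/
noncomputable def branchingOp (q : PMF ℕ) (μ : Measure ℝ) (f : ℝ → ℝ≥0∞) (x : ℝ) : ℝ≥0∞ :=
  ∑' k : ℕ, q k * (∫⁻ z, f (x + z) ∂μ) ^ k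

section OneStep

variable {q : PMF ℕ} {μ : Measure ℝ} [IsProbabilityMeasure μ]

theorem measurable_lintegral_add {f : ℝ → ℝ≥0∞} (hf : Measurable f) :
    Measurable fun x => ∫⁻ z, f (x + z) ∂μ :=
  Measurable.lintegral_prod_right (f := fun x z => f (x + z)) (hf.comp measurable_add)

theorem measurable_branchingOp {f : ℝ → ℝ≥0∞} (hf : Measurable f) :
    Measurable (branchingOp q μ f) :=
  Measurable.tsum fun _ => ((measurable_lintegral_add hf).pow_const _).const_mul _

/-- With the tree frozen, the steps into generation `m + 1` affect neither `F` nor the positions of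
the parents. They integrate out separately, and the `N u` siblings contribute equal factors. -/
theorem lintegral_steps {m : ℕ} {F : (List ℕ → ℕ) → (List ℕ → ℝ) → ℝ≥0∞}
    (hF : Measurable (Function.uncurry F)) (hFm : DependsUpTo m F) {f : ℝ → ℝ≥0∞}
    (hf : Measurable f) (N : List ℕ → ℕ) :
    ∫⁻ X, F N X * ∏ v ∈ generationFinset N (m + 1), f (position X v)
        ∂(Measure.infinitePi fun _ : List ℕ => μ) =
      ∫⁻ X, F N X * ∏ u ∈ generationFinset N m, (∫⁻ z, f (position X u + z) ∂μ) ^ N u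
        ∂(Measure.infinitePi fun _ : List ℕ => μ) := by
  have hlen : ∀ v ∈ generationFinset N (m + 1), v.length = m + 1 := fun v hv =>
    (mem_generationFinset.1 hv).1
  have key := lintegral_infinitePi_mul_prod μ (generationFinset N (m + 1)) (G := fun X => F N X)
    (h := fun v X z => f (position X v.tail + z)) (hF.comp (measurable_const.prodMk measurable_id))
    (fun v => hf.comp (((measurable_position _).comp measurable_fst).add measurable_snd))
    (fun v hv X z => hFm _ _ _ _ (fun _ _ => rfl) fun u hu =>
      Function.update_of_ne (fun e => by rw [e, hlen v hv] at hu; omega) _ _)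
    (fun v hv w hw X z => by
      funext y
      rw [position_congr (X' := X) fun u hu => Function.update_of_ne (fun e => by
        rw [e, hlen w hw, List.length_tail, hlen v hv] at hu; omega) _ _])
  rw [lintegral_congr fun X => ?_, key, lintegral_congr fun X => ?_]
  · rw [← prod_generationFinset_succ N m fun u => ∫⁻ z, f (position X u + z) ∂μ]
  · congr 1
    refine Finset.prod_congr rfl fun v hv => ?_
    cases v with
    | nil => simpa using hlen _ hv
    | cons i u => rfl

/-- The numbers of children in generation `m` influence neither `F` nor the set of nodes of that
generation, so they integrate out once this set is fixed. -/
theorem lintegral_offspring {m : ℕ} {F : (List ℕ → ℕ) → (List ℕ → ℝ) → ℝ≥0∞}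
    (hF : Measurable (Function.uncurry F)) (hFm : DependsUpTo m F) (X : List ℕ → ℝ)
    (a : List ℕ → ℝ≥0∞) :
    ∫⁻ N, F N X * ∏ u ∈ generationFinset N m, a u ^ N u
        ∂(Measure.infinitePi fun _ : List ℕ => q.toMeasure) =
      ∫⁻ N, F N X * ∏ u ∈ generationFinset N m, ∑' k : ℕ, q k * a u ^ k
        ∂(Measure.infinitePi fun _ : List ℕ => q.toMeasure) := by
  have hFX : Measurable fun N => F N X := hF.comp (measurable_id.prodMk measurable_const)
  have hind : ∀ D : Finset (List ℕ), Measurable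
      ({N : List ℕ → ℕ | generationFinset N m = D}.indicator (1 : (List ℕ → ℕ) → ℝ≥0∞)) := fun D =>
    measurable_one.indicator (measurableSet_generationFinset_eq m D)
  have hint : ∀ u, ∑' k : ℕ, q k * a u ^ k = ∫⁻ k : ℕ, a u ^ k ∂q.toMeasure := by
    intro u
    rw [lintegral_countable']
    refine tsum_congr fun k => ?_
    rw [PMF.toMeasure_apply_singleton _ _ (measurableSet_singleton k), mul_comm]
  simp_rw [prod_generationFinset_eq_tsum, ← ENNReal.tsum_mul_left]
  rw [lintegral_tsum, lintegral_tsum]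
  · refine tsum_congr fun D => ?_
    simp_rw [← mul_assoc, hint]
    -- Only sets of words of length `m` can be a generation `m`; for the others both sides vanish.
    by_cases hD : ∀ v ∈ D, v.length = m
    · refine lintegral_infinitePi_mul_prod q.toMeasure D
        (G := fun N => F N X * {N : List ℕ → ℕ | generationFinset N m = D}.indicator 1 N)
        (h := fun u _ k => a u ^ k) (hFX.mul (hind D))
        (fun v => (measurable_of_countable fun k : ℕ => a v ^ k).comp measurable_snd) ?_
        (fun _ _ _ _ _ _ => rfl)
      intro v hv N z
      have hag : ∀ u : List ℕ, u.length < m → Function.update N v z u = N u := fun u hu =>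
        Function.update_of_ne (fun e => by rw [e, hD v hv] at hu; omega) _ _
      simp only [Set.indicator_apply, Set.mem_ofPred_eq, generationFinset_congr hag,
        hFm _ N X X hag fun _ _ => rfl, Pi.one_apply]
    · have h0 : ∀ N : List ℕ → ℕ,
          {N : List ℕ → ℕ | generationFinset N m = D}.indicator (1 : (List ℕ → ℕ) → ℝ≥0∞) N = 0 := by
        intro N
        refine Set.indicator_of_notMem (fun h => hD fun v hv => ?_) _
        rw [Set.mem_ofPred_eq] at h
        exact (mem_generationFinset.1 (h ▸ hv)).1
      simp [h0]
  · exact fun D => (hFX.mul ((hind D).mul measurable_const)).aemeasurable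
  · refine fun D => (hFX.mul ((hind D).mul (Finset.measurable_fun_prod _ fun u _ => ?_))).aemeasurable
    exact (measurable_of_countable fun k : ℕ => a u ^ k).comp (measurable_pi_apply u)

theorem measurable_prod_position (n : ℕ) {f : ℝ → ℝ≥0∞} (hf : Measurable f) :
    Measurable fun p : (List ℕ → ℕ) × (List ℕ → ℝ) =>
      ∏ v ∈ generationFinset p.1 n, f (position p.2 v) :=
  measurable_prod_generationFinset n fun v => hf.comp ((measurable_position v).comp measurable_snd)

theorem lintegral_prod_generation_succ {m : ℕ} {F : (List ℕ → ℕ) → (List ℕ → ℝ) → ℝ≥0∞}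
    (hF : Measurable (Function.uncurry F)) (hFm : DependsUpTo m F) {f : ℝ → ℝ≥0∞}
    (hf : Measurable f) :
    ∫⁻ p, F p.1 p.2 * ∏ v ∈ generationFinset p.1 (m + 1), f (position p.2 v) ∂(canonicalLaw q μ) =
      ∫⁻ p, F p.1 p.2 * ∏ v ∈ generationFinset p.1 m, branchingOp q μ f (position p.2 v)
        ∂(canonicalLaw q μ) := by
  have hmid : Measurable fun p : (List ℕ → ℕ) × (List ℕ → ℝ) =>
      ∏ u ∈ generationFinset p.1 m, (∫⁻ z, f (position p.2 u + z) ∂μ) ^ p.1 u := by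
    refine measurable_prod_generationFinset m fun v => ?_
    exact ((measurable_lintegral_add hf).comp ((measurable_position v).comp measurable_snd)).pow
      ((measurable_pi_apply v).comp measurable_fst)
  unfold canonicalLaw
  refine (lintegral_prod (fun p : (List ℕ → ℕ) × (List ℕ → ℝ) => F p.1 p.2 *
    ∏ v ∈ generationFinset p.1 (m + 1), f (position p.2 v))
    (hF.mul (measurable_prod_position _ hf)).aemeasurable).trans ?_
  refine Eq.trans ?_ (lintegral_prod_symm (fun p : (List ℕ → ℕ) × (List ℕ → ℝ) => F p.1 p.2 *
    ∏ v ∈ generationFinset p.1 m, branchingOp q μ f (position p.2 v))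
    (hF.mul (measurable_prod_position _ (measurable_branchingOp hf))).aemeasurable).symm
  simp only [lintegral_steps hF hFm hf]
  refine (lintegral_lintegral_swap (f := fun N X => F N X * ∏ u ∈ generationFinset N m,
    (∫⁻ z, f (position X u + z) ∂μ) ^ N u) (hF.mul hmid).aemeasurable).trans ?_
  refine lintegral_congr fun X => ?_
  exact lintegral_offspring hF hFm X fun u => ∫⁻ z, f (position X u + z) ∂μ

theorem lintegral_prod_generation_add {m : ℕ} {F : (List ℕ → ℕ) → (List ℕ → ℝ) → ℝ≥0∞}
    (hF : Measurable (Function.uncurry F)) (hFm : DependsUpTo m F) {f : ℝ → ℝ≥0∞}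
    (hf : Measurable f) (k : ℕ) :
    ∫⁻ p, F p.1 p.2 * ∏ v ∈ generationFinset p.1 (m + k), f (position p.2 v) ∂(canonicalLaw q μ) =
      ∫⁻ p, F p.1 p.2 * ∏ v ∈ generationFinset p.1 m, (branchingOp q μ)^[k] f (position p.2 v)
        ∂(canonicalLaw q μ) := by
  induction k generalizing f with
  | zero => rfl
  | succ k ih =>
    rw [← add_assoc, lintegral_prod_generation_succ hF (hFm.mono (Nat.le_add_right _ _)) hf,
      ih (measurable_branchingOp hf), Function.iterate_succ_apply]

theorem lintegral_prod_generation {f : ℝ → ℝ≥0∞} (hf : Measurable f) (n : ℕ) :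
    ∫⁻ p, ∏ v ∈ generationFinset p.1 n, f (position p.2 v) ∂(canonicalLaw q μ) =
      (branchingOp q μ)^[n] f 0 := by
  have := lintegral_prod_generation_add (q := q) (μ := μ) (m := 0) (F := fun _ _ => 1)
    measurable_const (fun _ _ _ _ _ _ => rfl) hf n
  simpa [generationFinset_zero, position] using this

end OneStep

/-! ### Generating function of the offspring law. -/

/-- The probability generating function of the offspring distribution. -/
noncomputable def offspringPgf (q : PMF ℕ) (s : ℝ≥0∞) : ℝ≥0∞ := ∑' k : ℕ, q k * s ^ k

theorem offspringPgf_mono (q : PMF ℕ) : Monotone (offspringPgf q) := fun _ _ h =>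
  ENNReal.tsum_le_tsum fun _ => by gcongr

theorem exp_le_one_add_add_sq_mul_exp_abs (x : ℝ) :
    Real.exp x ≤ 1 + x + x ^ 2 * Real.exp |x| := by
  have h1 : 1 ≤ Real.exp |x| := Real.one_le_exp (abs_nonneg x)
  by_cases hx : |x| ≤ 1
  · have := (abs_le.1 (Real.abs_exp_sub_one_sub_id_le hx)).2
    nlinarith [sq_nonneg x]
  · rcases le_total 0 x with h | h
    · rw [abs_of_nonneg h] at *
      have : 1 ≤ x ^ 2 := by nlinarith
      nlinarith [Real.exp_pos x]
    · rw [abs_of_nonpos h] at *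
      have h2 : Real.exp x ≤ 1 := Real.exp_le_one_iff.2 h
      nlinarith [sq_nonneg x]

section Offspring

variable {q : PMF ℕ}

theorem hasSum_toReal (q : PMF ℕ) : HasSum (fun k => (q k).toReal) 1 := by
  have h := q.tsum_coe
  have h2 := ENNReal.hasSum_toReal (f := q) (by rw [h]; simp)
  rwa [← ENNReal.tsum_toReal_eq (fun k => q.apply_ne_top k), h, ENNReal.toReal_one] at h2

theorem summable_mul_of_exp {θ : ℝ} (hθ : 0 < θ)
    (hq : Summable fun k : ℕ => (q k).toReal * Real.exp (θ * k)) :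
    Summable fun k : ℕ => (q k).toReal * k := by
  refine Summable.of_nonneg_of_le (fun k => by positivity) (fun k => ?_) (hq.mul_left (1 / θ))
  have h1 : θ * k ≤ Real.exp (θ * k) := by linarith [Real.add_one_le_exp (θ * k)]
  have h2 : (k : ℝ) ≤ 1 / θ * Real.exp (θ * k) := by
    rw [one_div, ← div_eq_inv_mul, le_div_iff₀ hθ]; linarith
  calc (q k).toReal * k ≤ (q k).toReal * (1 / θ * Real.exp (θ * k)) := by gcongr
    _ = _ := by ring

theorem one_lt_mean (hq0 : q 0 = 0) (hq1 : q 1 < 1)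
    (hs : Summable fun k : ℕ => (q k).toReal * k) : 1 < ∑' k : ℕ, (q k).toReal * k := by
  have hone := hasSum_toReal q
  obtain ⟨i, hi2, hi⟩ : ∃ i : ℕ, 2 ≤ i ∧ q i ≠ 0 := by
    by_contra! h
    have : ∑' k, q k = q 1 := tsum_eq_single 1 fun k hk => by
      rcases Nat.lt_or_ge k 2 with h2 | h2
      · interval_cases k
        · exact hq0
        · exact absurd rfl hk
      · exact h k h2
    rw [q.tsum_coe] at this
    exact hq1.ne this.symm
  rw [← hone.tsum_eq]
  refine Summable.tsum_lt_tsum (i := i) (fun k => ?_) ?_ hone.summable hs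
  · rcases Nat.eq_zero_or_pos k with rfl | hk
    · simp [hq0]
    · exact le_mul_of_one_le_right ENNReal.toReal_nonneg (Nat.one_le_cast.2 hk)
  · have hpos : 0 < (q i).toReal := ENNReal.toReal_pos hi (q.apply_ne_top i)
    exact lt_mul_of_one_lt_right hpos (by exact_mod_cast hi2)

theorem mul_ofReal_exp_pow (t : ℝ) (k : ℕ) :
    q k * ENNReal.ofReal (Real.exp t) ^ k = ENNReal.ofReal ((q k).toReal * Real.exp (t * k)) := by
  rw [ENNReal.ofReal_mul ENNReal.toReal_nonneg, ENNReal.ofReal_toReal (q.apply_ne_top k),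
    ← ENNReal.ofReal_pow (Real.exp_pos t).le, ← Real.exp_nat_mul, mul_comm t]

/-- Near `0` the cumulant generating function of the offspring distribution is at most
`t ↦ m t + B t ^ 2`. -/
theorem exists_offspringPgf_exp_le {θ : ℝ} (hθ : 0 < θ)
    (hq : Summable fun k : ℕ => (q k).toReal * Real.exp (θ * k)) :
    ∃ t₀ > 0, ∃ B ≥ 0, ∀ t : ℝ, |t| ≤ t₀ → offspringPgf q (ENNReal.ofReal (Real.exp t)) ≤
      ENNReal.ofReal (Real.exp ((∑' k : ℕ, (q k).toReal * k) * t + B * t ^ 2)) := by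
  have hone := hasSum_toReal q
  have hmean := summable_mul_of_exp hθ hq
  -- Half of the exponential moment pays for `exp |t k|`, the other half for `k ^ 2`: from `u ^ 2 /
  -- 2 ≤ exp u` at `u = θ k / 2` comes the constant `8 / θ ^ 2`.
  refine ⟨θ / 2, by positivity, 8 / θ ^ 2 * ∑' k : ℕ, (q k).toReal * Real.exp (θ * k),
    mul_nonneg (by positivity) (tsum_nonneg fun k => by positivity), fun t ht => ?_⟩
  have hterm : ∀ k : ℕ, (q k).toReal * Real.exp (t * k) ≤ (q k).toReal +
      (q k).toReal * k * t + 8 / θ ^ 2 * ((q k).toReal * Real.exp (θ * k)) * t ^ 2 := by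
    intro k
    have hk : (0 : ℝ) ≤ k := k.cast_nonneg
    have h1 := exp_le_one_add_add_sq_mul_exp_abs (t * k)
    have h2 : Real.exp |t * k| ≤ Real.exp (θ / 2 * k) := by
      rw [Real.exp_le_exp, abs_mul, abs_of_nonneg hk]
      gcongr
    have h3 : (k : ℝ) ^ 2 ≤ 8 / θ ^ 2 * Real.exp (θ / 2 * k) := by
      have := Real.quadratic_le_exp_of_nonneg (x := θ / 2 * k) (by positivity)
      rw [div_mul_eq_mul_div, le_div_iff₀ (by positivity)]
      nlinarith [mul_nonneg hθ.le hk]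
    have h4 : Real.exp (θ * k) = Real.exp (θ / 2 * k) * Real.exp (θ / 2 * k) := by
      rw [← Real.exp_add]; congr 1; ring
    have h5 : (t * k) ^ 2 * Real.exp |t * k| ≤ 8 / θ ^ 2 * Real.exp (θ * k) * t ^ 2 := by
      calc (t * k) ^ 2 * Real.exp |t * k|
          ≤ (t * k) ^ 2 * Real.exp (θ / 2 * k) := by gcongr
        _ = (k : ℝ) ^ 2 * (t ^ 2 * Real.exp (θ / 2 * k)) := by ring
        _ ≤ (8 / θ ^ 2 * Real.exp (θ / 2 * k)) * (t ^ 2 * Real.exp (θ / 2 * k)) := by gcongr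
        _ = _ := by rw [h4]; ring
    calc (q k).toReal * Real.exp (t * k)
        ≤ (q k).toReal * (1 + t * k + 8 / θ ^ 2 * Real.exp (θ * k) * t ^ 2) := by
          gcongr; linarith
      _ = _ := by ring
  have hbound := ((hone.add (hmean.hasSum.mul_right t)).add
    ((hq.hasSum.mul_left (8 / θ ^ 2)).mul_right (t ^ 2)))
  have hsum : Summable fun k : ℕ => (q k).toReal * Real.exp (t * k) :=
    Summable.of_nonneg_of_le (fun k => by positivity) hterm hbound.summable
  unfold offspringPgf
  simp_rw [mul_ofReal_exp_pow]
  rw [← ENNReal.ofReal_tsum_of_nonneg (fun k => by positivity) hsum]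
  refine ENNReal.ofReal_le_ofReal ?_
  calc _ ≤ _ := hasSum_le hterm hsum.hasSum hbound
    _ ≤ _ := by
      have := Real.add_one_le_exp ((∑' k : ℕ, (q k).toReal * k) * t +
        (8 / θ ^ 2 * ∑' k : ℕ, (q k).toReal * Real.exp (θ * k)) * t ^ 2)
      linarith

/-- Since `q 0 = 0`, all the mass outside `1` sits at `k ≥ 2`, where `s ^ k ≤ s ^ 2`. -/
theorem offspringPgf_le (hq0 : q 0 = 0) {s : ℝ} (hs0 : 0 ≤ s) (hs1 : s ≤ 1) :
    offspringPgf q (ENNReal.ofReal s) ≤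
      ENNReal.ofReal (s * ((q 1).toReal + (1 - (q 1).toReal) * s)) := by
  have hone := hasSum_toReal q
  have hle : ∀ k : ℕ, (q k).toReal * s ^ k ≤
      (q k).toReal * s ^ 2 + if k = 1 then (q 1).toReal * (s - s ^ 2) else 0 := by
    intro k
    match k with
    | 0 => simp [hq0]
    | 1 => simp; ring_nf; rfl
    | k + 2 =>
      have : s ^ (k + 2) ≤ s ^ 2 := pow_le_pow_of_le_one hs0 hs1 (by omega)
      simp only [show k + 2 ≠ 1 by omega, if_false, add_zero]
      gcongr
  have hb := (hone.mul_right (s ^ 2)).add (hasSum_ite_eq 1 ((q 1).toReal * (s - s ^ 2)))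
  have hsum : Summable fun k : ℕ => (q k).toReal * s ^ k :=
    Summable.of_nonneg_of_le (fun k => by positivity) hle hb.summable
  have hterm : ∀ k, q k * ENNReal.ofReal s ^ k = ENNReal.ofReal ((q k).toReal * s ^ k) := fun k => by
    rw [ENNReal.ofReal_mul ENNReal.toReal_nonneg, ENNReal.ofReal_toReal (q.apply_ne_top k),
      ENNReal.ofReal_pow hs0]
  unfold offspringPgf
  simp_rw [hterm]
  rw [← ENNReal.ofReal_tsum_of_nonneg (fun k => by positivity) hsum]
  refine ENNReal.ofReal_le_ofReal ((hasSum_le hle hsum.hasSum hb).trans (le_of_eq ?_))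
  ring

/-- The iterates of the generating function decay geometrically, at any rate above `q 1`. -/
theorem exists_iterate_offspringPgf_le (hq0 : q 0 = 0) {r s : ℝ} (hr : (q 1).toReal < r)
    (hr1 : r < 1) (hs0 : 0 ≤ s) (hs1 : s < 1) :
    ∃ C > 0, ∀ m : ℕ, (offspringPgf q)^[m] (ENNReal.ofReal s) ≤ ENNReal.ofReal (C * r ^ m) := by
  set p₁ := (q 1).toReal with hp₁
  have hp0 : 0 ≤ p₁ := ENNReal.toReal_nonneg
  have hp1 : p₁ < 1 := hr.trans hr1
  have hr0 : 0 < r := hp0.trans_lt hr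
  -- The dominating sequence has ratios `p₁ + (1 - p₁) * a m`. A crude geometric bound first sends
  -- `a m` to `0`; from some `m₀` on the ratio is therefore below `r`, and `C` compensates for the
  -- first `m₀` terms.
  let a : ℕ → ℝ := fun m => (fun t => t * (p₁ + (1 - p₁) * t))^[m] s
  have ha_succ : ∀ m, a (m + 1) = a m * (p₁ + (1 - p₁) * a m) := fun m =>
    Function.iterate_succ_apply' _ _ _
  have ha : ∀ m, 0 ≤ a m ∧ a m ≤ s * (p₁ + (1 - p₁) * s) ^ m ∧ a m ≤ s := by
    have hρ0 : 0 ≤ p₁ + (1 - p₁) * s := by nlinarith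
    have hρ1 : p₁ + (1 - p₁) * s ≤ 1 := by nlinarith
    intro m
    induction m with
    | zero => exact ⟨hs0, by simp [a], le_rfl⟩
    | succ m ih =>
      obtain ⟨h0, h1, h2⟩ := ih
      rw [ha_succ]
      have hq' : p₁ + (1 - p₁) * a m ≤ p₁ + (1 - p₁) * s := by nlinarith
      have hq0' : 0 ≤ p₁ + (1 - p₁) * a m := by nlinarith
      refine ⟨mul_nonneg h0 hq0', ?_, ?_⟩
      · rw [pow_succ, ← mul_assoc]
        exact mul_le_mul h1 hq' hq0' (h0.trans h1)
      · nlinarith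
  have hiter : ∀ m, (offspringPgf q)^[m] (ENNReal.ofReal s) ≤ ENNReal.ofReal (a m) := by
    intro m
    induction m with
    | zero => exact le_rfl
    | succ m ih =>
      rw [Function.iterate_succ_apply', ha_succ]
      exact (offspringPgf_mono q ih).trans (offspringPgf_le hq0 (ha m).1 ((ha m).2.2.trans hs1.le))
  have htend : Tendsto (fun m => s * (p₁ + (1 - p₁) * s) ^ m) atTop (𝓝 0) := by
    have := (tendsto_pow_atTop_nhds_zero_of_lt_one (r := p₁ + (1 - p₁) * s)
      (by nlinarith) (by nlinarith)).const_mul s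
    simpa using this
  obtain ⟨m₀, hm₀⟩ := eventually_atTop.1 (htend.eventually (gt_mem_nhds (sub_pos.2 hr)))
  have hratio : ∀ j, a (m₀ + j) ≤ r ^ j := by
    intro j
    induction j with
    | zero => simpa using (ha m₀).2.2.trans hs1.le
    | succ j ih =>
      rw [← add_assoc, ha_succ, pow_succ]
      obtain ⟨h0, h1, -⟩ := ha (m₀ + j)
      have := hm₀ (m₀ + j) (Nat.le_add_right _ _)
      exact mul_le_mul ih (by nlinarith) (by nlinarith) (by positivity)
  refine ⟨(r ^ m₀)⁻¹, by positivity, fun m => (hiter m).trans (ENNReal.ofReal_le_ofReal ?_)⟩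
  rw [← div_eq_inv_mul, le_div_iff₀ (by positivity)]
  rcases le_total m₀ m with h | h
  · obtain ⟨j, rfl⟩ := Nat.exists_eq_add_of_le h
    have h1 : r ^ m₀ ≤ 1 := pow_le_one₀ hr0.le hr1.le
    have h2 := hratio j
    calc a (m₀ + j) * r ^ m₀ ≤ r ^ j * r ^ m₀ := by gcongr
      _ = r ^ (m₀ + j) := by rw [add_comm, pow_add]
  · calc a m * r ^ m₀ ≤ 1 * r ^ m := mul_le_mul ((ha m).2.2.trans hs1.le)
          (pow_le_pow_of_le_one hr0.le hr1.le h) (by positivity) zero_le_one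
      _ = r ^ m := one_mul _

end Offspring

/-! ### Chernoff estimate for iterates of the branching operator. -/

section Operator

variable {q : PMF ℕ} {μ : Measure ℝ}

theorem branchingOp_eq_offspringPgf (f : ℝ → ℝ≥0∞) (x : ℝ) :
    branchingOp q μ f x = offspringPgf q (∫⁻ z, f (x + z) ∂μ) := rfl

variable [IsProbabilityMeasure μ]

theorem iterate_branchingOp_le {f : ℝ → ℝ≥0∞} {s : ℝ≥0∞} (hf : ∀ x, f x ≤ s) (m : ℕ) (x : ℝ) :
    (branchingOp q μ)^[m] f x ≤ (offspringPgf q)^[m] s := by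
  induction m generalizing x with
  | zero => exact hf x
  | succ m ih =>
    rw [Function.iterate_succ_apply', Function.iterate_succ_apply', branchingOp_eq_offspringPgf]
    refine offspringPgf_mono q ((lintegral_mono fun z => ih (x + z)).trans ?_)
    simp

/-- The law of the position of a walk with `k` i.i.d. steps of law `μ`. -/
noncomputable def walkLaw (μ : Measure ℝ) : ℕ → Measure ℝ
  | 0 => Measure.dirac 0
  | k + 1 => μ ∗ walkLaw μ k

instance isProbabilityMeasure_walkLaw (k : ℕ) : IsProbabilityMeasure (walkLaw μ k) := by
  induction k with
  | zero => exact Measure.dirac.isProbabilityMeasure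
  | succ k ih => unfold walkLaw; infer_instance

variable {g : ℝ → ℝ}

theorem integrable_comp_add (hg : Measurable g) (hg1 : ∀ x, |g x| ≤ 1) (ρ : Measure ℝ)
    [IsProbabilityMeasure ρ] (x : ℝ) : Integrable (fun s => g (x + s)) ρ :=
  Integrable.of_bound (hg.comp (measurable_const_add x)).aestronglyMeasurable 1
    (ae_of_all _ fun s => hg1 (x + s))

theorem abs_integral_comp_add_le (hg1 : ∀ x, |g x| ≤ 1) (ρ : Measure ℝ)
    [IsProbabilityMeasure ρ] (x : ℝ) : |∫ s, g (x + s) ∂ρ| ≤ 1 := by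
  simpa using norm_integral_le_of_norm_le_const (μ := ρ) (f := fun s => g (x + s)) (C := 1) (ae_of_all _
    fun s => hg1 (x + s))

theorem measurable_integral_comp_add (hg : Measurable g) (ρ : Measure ℝ) [IsProbabilityMeasure ρ] :
    Measurable fun x => ∫ s, g (x + s) ∂ρ := by
  have : StronglyMeasurable (Function.uncurry fun x s : ℝ => g (x + s)) :=
    (hg.comp measurable_add).stronglyMeasurable
  exact this.integral_prod_right.measurable

theorem integral_walkLaw_succ (hg : Measurable g) (hg1 : ∀ x, |g x| ≤ 1) (k : ℕ) (x : ℝ) :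
    ∫ s, g (x + s) ∂(walkLaw μ (k + 1)) = ∫ z, ∫ s, g (x + z + s) ∂(walkLaw μ k) ∂μ := by
  have : walkLaw μ (k + 1) = μ ∗ walkLaw μ k := rfl
  rw [this, integral_conv]
  · simp only [add_assoc]
  · exact integrable_comp_add hg hg1 _ x

/-- One generation of the Chernoff estimate. -/
theorem branchingOp_exp_le {M B t₀ C l : ℝ} (hB : 0 ≤ B)
    (hpgf : ∀ t : ℝ, |t| ≤ t₀ → offspringPgf q (ENNReal.ofReal (Real.exp t)) ≤
      ENNReal.ofReal (Real.exp (M * t + B * t ^ 2)))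
    (hC0 : 0 ≤ C) (hC : M * (C + 1) + 4 * B ≤ C * M ^ 2) (hl0 : 0 ≤ l) (hl1 : (C + 1) * l ≤ 1)
    (hl2 : 2 * l ≤ t₀) (hg : Measurable g) (hg1 : ∀ x, |g x| ≤ 1) {f : ℝ → ℝ≥0∞}
    (hf : ∀ x, f x ≤ ENNReal.ofReal (Real.exp (l * g x + C * l ^ 2))) (x : ℝ) :
    branchingOp q μ f x ≤
      ENNReal.ofReal (Real.exp (l * M * (∫ z, g (x + z) ∂μ) + C * (l * M) ^ 2)) := by
  have hl1' : l ≤ 1 := by nlinarith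
  have hint := integrable_comp_add hg hg1 μ x
  set g' := ∫ z, g (x + z) ∂μ with hg'
  have hg'1 : |g'| ≤ 1 := abs_integral_comp_add_le hg1 μ x
  -- As `|l * g y| ≤ 1`, the bound `exp u ≤ 1 + u + u ^ 2` applies: integrating over one step costs
  -- one extra `l ^ 2`, so `C` becomes `C + 1`.
  have hpt : ∀ y, Real.exp (l * g y + C * l ^ 2) ≤
      Real.exp (C * l ^ 2) * (1 + l * g y + l ^ 2) := by
    intro y
    rw [add_comm, Real.exp_add]
    gcongr
    have h1 := abs_le.1 (hg1 y)
    have h2 : |l * g y| ≤ 1 := by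
      rw [abs_mul, abs_of_nonneg hl0]
      exact mul_le_one₀ hl1' (abs_nonneg _) (hg1 y)
    have h3 := (abs_le.1 (Real.abs_exp_sub_one_sub_id_le h2)).2
    have h4 : (l * g y) ^ 2 ≤ l ^ 2 := by
      rw [mul_pow]
      exact mul_le_of_le_one_right (sq_nonneg l) (by nlinarith)
    linarith
  have hpos : ∀ y, 0 ≤ Real.exp (C * l ^ 2) * (1 + l * g y + l ^ 2) := fun y =>
    (Real.exp_pos _).le.trans (hpt y)
  have hint1 : Integrable (fun z => 1 + l * g (x + z)) μ :=
    (integrable_const 1).add (hint.const_mul l)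
  have hint2 : Integrable (fun z => Real.exp (C * l ^ 2) * (1 + l * g (x + z) + l ^ 2)) μ :=
    (hint1.add (integrable_const _)).const_mul _
  have hstep : ∫⁻ z, f (x + z) ∂μ ≤
      ENNReal.ofReal (Real.exp (l * g' + (C + 1) * l ^ 2)) := by
    calc ∫⁻ z, f (x + z) ∂μ
        ≤ ∫⁻ z, ENNReal.ofReal (Real.exp (C * l ^ 2) * (1 + l * g (x + z) + l ^ 2)) ∂μ :=
          lintegral_mono fun z => (hf _).trans (ENNReal.ofReal_le_ofReal (hpt _))
      _ = ENNReal.ofReal (Real.exp (C * l ^ 2) * (1 + l * g' + l ^ 2)) := by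
          rw [← ofReal_integral_eq_lintegral_ofReal hint2 (ae_of_all _ fun z => hpos _),
            integral_const_mul, integral_add hint1 (integrable_const _),
            integral_add (integrable_const 1) (hint.const_mul l), integral_const_mul]
          simp [hg']
      _ ≤ _ := by
          refine ENNReal.ofReal_le_ofReal ?_
          have : l * g' + (C + 1) * l ^ 2 = C * l ^ 2 + (l * g' + l ^ 2) := by ring
          rw [this, Real.exp_add]
          gcongr
          linarith [Real.add_one_le_exp (l * g' + l ^ 2)]
  set t := l * g' + (C + 1) * l ^ 2 with ht
  have ht2 : |t| ≤ 2 * l := by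
    have h1 : |l * g'| ≤ l := by
      rw [abs_mul, abs_of_nonneg hl0]
      exact mul_le_of_le_one_right hl0 hg'1
    have h2 : |(C + 1) * l ^ 2| ≤ l := by
      rw [abs_of_nonneg (by positivity)]; nlinarith
    linarith [abs_add_le (l * g') ((C + 1) * l ^ 2)]
  rw [branchingOp_eq_offspringPgf]
  refine ((offspringPgf_mono q hstep).trans (hpgf t (ht2.trans hl2))).trans ?_
  refine ENNReal.ofReal_le_ofReal (Real.exp_le_exp.2 ?_)
  have ht3 : t ^ 2 ≤ 4 * l ^ 2 := by
    rw [← sq_abs t]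
    nlinarith [abs_nonneg t]
  have hBt : B * t ^ 2 ≤ B * (4 * l ^ 2) := by gcongr
  -- The condition `hC` makes the error reproduce itself: `M * (C + 1) * l ^ 2 + 4 * B * l ^ 2 ≤ C *
  -- (l * M) ^ 2`.
  have hCl := mul_le_mul_of_nonneg_right hC (sq_nonneg l)
  rw [ht] at *
  nlinarith

/-- Each generation multiplies the parameter by `M` and keeps the same `C`. As `M > 1`, smallness at
the final value `l * M ^ k` implies it at all earlier ones. -/
theorem iterate_branchingOp_exp_le {M B t₀ C : ℝ} (hM : 1 < M) (hB : 0 ≤ B)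
    (hpgf : ∀ t : ℝ, |t| ≤ t₀ → offspringPgf q (ENNReal.ofReal (Real.exp t)) ≤
      ENNReal.ofReal (Real.exp (M * t + B * t ^ 2)))
    (hC0 : 0 ≤ C) (hC : M * (C + 1) + 4 * B ≤ C * M ^ 2) (hg : Measurable g)
    (hg1 : ∀ x, |g x| ≤ 1) (k : ℕ) {l : ℝ} (hl0 : 0 ≤ l) (hl1 : (C + 1) * (l * M ^ k) ≤ 1)
    (hl2 : 2 * (l * M ^ k) ≤ t₀) (x : ℝ) :
    (branchingOp q μ)^[k] (fun y => ENNReal.ofReal (Real.exp (l * g y))) x ≤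
      ENNReal.ofReal (Real.exp (l * M ^ k * (∫ s, g (x + s) ∂(walkLaw μ k)) +
        C * (l * M ^ k) ^ 2)) := by
  induction k generalizing x with
  | zero =>
    simp only [Function.iterate_zero, id, walkLaw, integral_dirac, add_zero, pow_zero, mul_one]
    refine ENNReal.ofReal_le_ofReal (Real.exp_le_exp.2 ?_)
    nlinarith [mul_nonneg hC0 (sq_nonneg l)]
  | succ k ih =>
    have hk : l * M ^ k ≤ l * M ^ (k + 1) := by
      gcongr
      · exact hM.le
      · omega
    have h0 : 0 ≤ l * M ^ k := by positivity
    have h1 : (C + 1) * (l * M ^ k) ≤ 1 := le_trans (by gcongr) hl1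
    have h2 : 2 * (l * M ^ k) ≤ t₀ := le_trans (by gcongr) hl2
    rw [Function.iterate_succ_apply', integral_walkLaw_succ hg hg1, pow_succ, ← mul_assoc]
    exact branchingOp_exp_le hB hpgf hC0 hC h0 h1 h2
      (measurable_integral_comp_add hg (walkLaw μ k))
      (fun y => abs_integral_comp_add_le hg1 _ y) (fun y => ih h1 h2 y) x

/-- The Chernoff estimate: if `g` has mean at most `-c` after a walk of `k` steps started at `x`,
then, with a parameter `l = L / M ^ k`, the exponential functional of generation `k` of a branching
random walk started at `x` has mean at most `s < 1`, and neither `L` nor `s` depends on `k`. -/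
theorem exists_iterate_branchingOp_exp_le (hq0 : q 0 = 0) (hq1 : q 1 < 1)
    (hq_exp : ∃ θ : ℝ, 0 < θ ∧ Summable (fun k : ℕ => (q k).toReal * Real.exp (θ * k)))
    {c : ℝ} (hc : 0 < c) :
    ∃ s : ℝ, 0 ≤ s ∧ s < 1 ∧ ∀ k : ℕ, ∃ l : ℝ, 0 < l ∧
      ∀ g : ℝ → ℝ, Measurable g → (∀ x, |g x| ≤ 1) → ∀ x,
        ∫ y, g (x + y) ∂(walkLaw μ k) ≤ -c →
        (branchingOp q μ)^[k] (fun y => ENNReal.ofReal (Real.exp (l * g y))) x ≤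
          ENNReal.ofReal s := by
  obtain ⟨θ, hθ, hq⟩ := hq_exp
  obtain ⟨t₀, ht₀, B, hB, hpgf⟩ := exists_offspringPgf_exp_le hθ hq
  have hM := one_lt_mean hq0 hq1 (summable_mul_of_exp hθ hq)
  set M := ∑' k : ℕ, (q k).toReal * k with hM_def
  -- The solution of `M * (C + 1) + 4 * B = C * M ^ 2`; supercriticality `M > 1` makes it positive.
  set C := (M + 4 * B) / (M * (M - 1)) with hC_def
  have hMM : 0 < M * (M - 1) := mul_pos (by linarith) (by linarith)
  have hC0 : 0 < C := by positivity
  have hC : M * (C + 1) + 4 * B ≤ C * M ^ 2 := by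
    have : C * (M * (M - 1)) = M + 4 * B := div_mul_cancel₀ _ hMM.ne'
    nlinarith
  -- The first two bounds keep the parameter in the range of the estimate; the third keeps the error
  -- `C * L ^ 2` below half of the gain `L * c`.
  set L := min (min (1 / (C + 1)) (t₀ / 2)) (c / (2 * C)) with hL
  have hL0 : 0 < L := by positivity
  have hL1 : (C + 1) * L ≤ 1 := by
    have : L ≤ 1 / (C + 1) := (min_le_left _ _).trans (min_le_left _ _)
    rw [le_div_iff₀ (by positivity)] at this
    linarith
  have hL2 : 2 * L ≤ t₀ := by
    have : L ≤ t₀ / 2 := (min_le_left _ _).trans (min_le_right _ _)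
    linarith
  have hL3 : C * L ≤ c / 2 := by
    have : L ≤ c / (2 * C) := min_le_right _ _
    rw [le_div_iff₀ (by positivity)] at this
    linarith
  refine ⟨Real.exp (-(L * c / 2)), (Real.exp_pos _).le, Real.exp_lt_one_iff.2 (by
    have : 0 < L * c / 2 := by positivity
    linarith), fun k => ?_⟩
  have hMk : 0 < M ^ k := by positivity
  refine ⟨L / M ^ k, by positivity, fun g hg hg1 x hx => ?_⟩
  have hcancel : L / M ^ k * M ^ k = L := div_mul_cancel₀ _ hMk.ne'
  refine (iterate_branchingOp_exp_le hM hB hpgf hC0.le hC hg hg1 k (l := L / M ^ k)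
    (by positivity) (by rwa [hcancel]) (by rwa [hcancel]) x).trans ?_
  rw [hcancel]
  refine ENNReal.ofReal_le_ofReal (Real.exp_le_exp.2 ?_)
  nlinarith

end Operator

/-! ### The event in terms of an exponential functional. -/

section Events

theorem count_eq_card (N : List ℕ → ℕ) (X : List ℕ → ℝ) (n : ℕ) (S : Set ℝ)
    [DecidablePred (· ∈ S)] :
    count N X n S = ((generationFinset N n).filter fun v => position X v ∈ S).card := by
  rw [count, ← Set.ncard_coe_finset]
  congr 1
  ext v
  simp [generation, mem_generationFinset]

theorem prod_exp_eq (N : List ℕ → ℕ) (X : List ℕ → ℝ) (n : ℕ) (S : Set ℝ) (l p : ℝ) :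
    ∏ v ∈ generationFinset N n,
        ENNReal.ofReal (Real.exp (l * (S.indicator 1 (position X v) - p))) =
      ENNReal.ofReal (Real.exp (l * (count N X n S - p * count N X n Set.univ))) := by
  classical
  rw [← ENNReal.ofReal_prod_of_nonneg fun _ _ => (Real.exp_pos _).le, ← Real.exp_sum,
    ← Finset.mul_sum, Finset.sum_sub_distrib, count_eq_card, count_eq_card]
  simp only [Set.indicator_apply, Pi.one_apply, Finset.sum_boole, Finset.sum_const, Set.mem_univ,
    Finset.filter_true, nsmul_eq_mul]
  rw [mul_comm p]

/-- If the empirical measure of `S` is at least `p`, the exponential functional is at least `1`. -/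
theorem one_le_prod_exp {N : List ℕ → ℕ} {X : List ℕ → ℝ} {n : ℕ} {S : Set ℝ} {l p : ℝ}
    (hl : 0 ≤ l) (hp : 0 < p) (h : p ≤ empirical N X n S) :
    1 ≤ ∏ v ∈ generationFinset N n,
      ENNReal.ofReal (Real.exp (l * (S.indicator 1 (position X v) - p))) := by
  rw [prod_exp_eq]
  have h0 : (0 : ℝ) < count N X n Set.univ := by
    refine (Nat.cast_nonneg _).lt_of_ne fun h0 => ?_
    rw [empirical, ← h0, div_zero] at h
    exact absurd h (not_le.2 hp)
  rw [empirical, le_div_iff₀ h0] at h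
  rw [ENNReal.one_le_ofReal, Real.one_le_exp_iff]
  exact mul_nonneg hl (by linarith)

theorem one_le_prod_exp_neg {N : List ℕ → ℕ} {X : List ℕ → ℝ} {n : ℕ} {S : Set ℝ} {l p : ℝ}
    (hl : 0 ≤ l) (h : empirical N X n S < p) :
    1 ≤ ∏ v ∈ generationFinset N n,
      ENNReal.ofReal (Real.exp (l * -(S.indicator 1 (position X v) - p))) := by
  have : ∀ v, l * -(S.indicator 1 (position X v) - p) =
      -l * (S.indicator 1 (position X v) - p) := fun v => by ring
  simp_rw [this]
  rw [prod_exp_eq, ENNReal.one_le_ofReal, Real.one_le_exp_iff]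
  have h1 : (count N X n S : ℝ) ≤ p * count N X n Set.univ := by
    -- In an empty generation `empirical` is `0 / 0 = 0`, and the inequality between the counts is
    -- `0 ≤ 0`.
    rcases (Nat.cast_nonneg (α := ℝ) (count N X n Set.univ)).eq_or_lt with h0 | h0
    · have hle : count N X n S ≤ count N X n Set.univ := by
        classical
        rw [count_eq_card, count_eq_card]
        exact Finset.card_le_card (Finset.monotone_filter_right _ fun v _ _ => Set.mem_univ _)
      have : (count N X n S : ℝ) ≤ count N X n Set.univ := by exact_mod_cast hle
      rw [← h0] at this ⊢
      linarith
    · rw [empirical, div_lt_iff₀ h0] at h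
      exact h.le
  nlinarith

end Events

/-! ### The event that the first generations do not branch. -/

section Spine

variable {q : PMF ℕ} {μ : Measure ℝ}

theorem replicate_ne_of_lt {m : ℕ} {u : List ℕ} (hu : u.length ≤ m) :
    u ≠ List.replicate (m + 1) 0 := fun e => by
  rw [e, List.length_replicate] at hu
  omega

theorem position_replicate (X : List ℕ → ℝ) (m : ℕ) :
    position X (List.replicate m 0) = ∑ j ∈ Finset.range m, X (List.replicate (j + 1) 0) := by
  induction m with
  | zero => rfl
  | succ m ih => rw [Finset.sum_range_succ, ← ih]; rfl

/-- Resampling the last step of the line, on which the earlier position does not depend, produces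
the convolution with `μ`. -/
theorem map_position_replicate [IsProbabilityMeasure μ] (m : ℕ) :
    (Measure.infinitePi fun _ : List ℕ => μ).map (fun X => position X (List.replicate m 0)) =
      walkLaw μ m := by
  induction m with
  | zero =>
    simp only [List.replicate_zero, position, Measure.map_const, measure_univ, one_smul]
    rfl
  | succ m ih =>
    refine Measure.ext_of_lintegral _ fun f hf => ?_
    have hconv : walkLaw μ (m + 1) = μ ∗ walkLaw μ m := rfl
    rw [lintegral_map hf (measurable_position _), hconv, Measure.lintegral_conv hf,
      lintegral_infinitePi_update μ (List.replicate (m + 1) 0)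
        (Φ := fun X => f (position X (List.replicate (m + 1) 0))) (hf.comp (measurable_position _))]
    have hpos : ∀ (X : List ℕ → ℝ) (z : ℝ),
        position (Function.update X (List.replicate (m + 1) 0) z) (List.replicate (m + 1) 0) =
          z + position X (List.replicate m 0) := by
      intro X z
      rw [add_comm z]
      show position (Function.update X (List.replicate (m + 1) 0) z) (List.replicate m 0) +
        Function.update X (List.replicate (m + 1) 0) z (List.replicate (m + 1) 0) = _
      rw [Function.update_self, position_congr (X' := X) fun u hu => Function.update_of_ne
        (replicate_ne_of_lt (by simpa using hu)) _ _]
    simp_rw [hpos]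
    rw [lintegral_lintegral_swap]
    · refine lintegral_congr fun z => ?_
      rw [← ih, lintegral_map (f := fun y => f (z + y)) (hf.comp (measurable_const_add z))
        (measurable_position _)]
    · exact (hf.comp (measurable_snd.add
        ((measurable_position _).comp measurable_fst))).aemeasurable

/-- The first `m` generations do not branch, and the only individual of generation `m` is located
in `I`. -/
def spineEvent (m : ℕ) (I : Set ℝ) : Set ((List ℕ → ℕ) × (List ℕ → ℝ)) :=
  {N | ∀ j < m, N (List.replicate j 0) = 1} ×ˢ {X | position X (List.replicate m 0) ∈ I}

theorem measurableSet_spineEvent (m : ℕ) {I : Set ℝ} (hI : MeasurableSet I) :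
    MeasurableSet (spineEvent m I) := by
  refine MeasurableSet.prod ?_ (measurable_position _ hI)
  have : {N : List ℕ → ℕ | ∀ j < m, N (List.replicate j 0) = 1} =
      ⋂ j, ⋂ _ : j < m, (fun N : List ℕ → ℕ => N (List.replicate j 0)) ⁻¹' {1} := by
    ext N; simp
  rw [this]
  exact MeasurableSet.iInter fun j => MeasurableSet.iInter fun _ =>
    measurable_pi_apply _ (measurableSet_singleton 1)

theorem canonicalLaw_spineEvent [IsProbabilityMeasure μ] (m : ℕ) {I : Set ℝ}
    (hI : MeasurableSet I) : canonicalLaw q μ (spineEvent m I) = q 1 ^ m * walkLaw μ m I := by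
  unfold canonicalLaw spineEvent
  rw [Measure.prod_prod, ← map_position_replicate, Measure.map_apply (measurable_position _) hI]
  congr 1
  have hinj : Function.Injective fun j : ℕ => List.replicate j (0 : ℕ) := fun i j h => by
    simpa using congrArg List.length h
  have : {N : List ℕ → ℕ | ∀ j < m, N (List.replicate j 0) = 1} =
      Set.pi ((Finset.range m).image fun j => List.replicate j 0 : Finset (List ℕ))
        fun _ => {1} := by
    ext N; simp
  rw [this, Measure.infinitePi_pi _ fun _ _ => measurableSet_singleton 1, Finset.prod_const,
    Finset.card_image_of_injective _ hinj, Finset.card_range,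
    PMF.toMeasure_apply_singleton _ _ (measurableSet_singleton 1)]

theorem generationFinset_of_spine {N : List ℕ → ℕ} {m : ℕ}
    (h : ∀ j < m, N (List.replicate j 0) = 1) :
    generationFinset N m = {List.replicate m 0} := by
  induction m with
  | zero => exact generationFinset_zero N
  | succ m ih =>
    have ih := ih fun j hj => h j (hj.trans (Nat.lt_succ_self m))
    have hmem : ∀ u : List ℕ, (u.length = m ∧ InTree N u) ↔ u = List.replicate m 0 := fun u => by
      rw [← mem_generationFinset, ih, Finset.mem_singleton]
    ext v
    rw [mem_generationFinset, Finset.mem_singleton]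
    cases v with
    | nil => simp [List.replicate_succ]
    | cons i u =>
      simp only [List.length_cons, Nat.add_right_cancel_iff, InTree, List.replicate_succ,
        List.cons.injEq]
      rw [← and_assoc, hmem]
      constructor
      · rintro ⟨rfl, hi⟩
        rw [h m (Nat.lt_succ_self m)] at hi
        exact ⟨by omega, rfl⟩
      · rintro ⟨rfl, rfl⟩
        exact ⟨rfl, by rw [h m (Nat.lt_succ_self m)]; omega⟩

theorem dependsUpTo_spineEvent (m : ℕ) (I : Set ℝ) :
    DependsUpTo m fun N X => (spineEvent m I).indicator 1 (N, X) := by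
  intro N N' X X' hN hX
  have : (N, X) ∈ spineEvent m I ↔ (N', X') ∈ spineEvent m I := by
    refine and_congr (forall₂_congr fun j hj => ?_) ?_
    · show N _ = 1 ↔ N' _ = 1
      rw [hN (List.replicate j 0) (by simpa using hj)]
    · show position X _ ∈ I ↔ position X' _ ∈ I
      rw [position_congr fun u hu => hX u (by simpa using hu)]
  by_cases h : (N, X) ∈ spineEvent m I
  · simp [Set.indicator_of_mem h, Set.indicator_of_mem (this.1 h)]
  · simp [Set.indicator_of_notMem h, Set.indicator_of_notMem (mt this.2 h)]

end Spine

/-! ### Non-asymptotic upper and lower bounds. -/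

section Bounds

variable {Ω : Type*} [MeasurableSpace Ω] {P : Measure Ω}
  {q : PMF ℕ} {μ : Measure ℝ} {N : List ℕ → Ω → ℕ} {X : List ℕ → Ω → ℝ}

theorem IsBRW.measurable_pair (h : IsBRW P q μ N X) :
    Measurable fun ω => ((fun u => N u ω), (fun u => X u ω)) :=
  (measurable_pi_iff.2 h.measurable_N).prodMk (measurable_pi_iff.2 h.measurable_X)

variable [IsProbabilityMeasure P] [IsProbabilityMeasure μ]

theorem measurable_ofReal_exp {S : Set ℝ} (hS : MeasurableSet S) (l p : ℝ) :
    Measurable fun y => ENNReal.ofReal (Real.exp (l * (S.indicator 1 y - p))) :=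
  (Real.measurable_exp.comp
    (((measurable_one.indicator hS).sub_const p).const_mul l)).ennreal_ofReal

theorem measurable_ofReal_exp_neg {S : Set ℝ} (hS : MeasurableSet S) (l p : ℝ) :
    Measurable fun y => ENNReal.ofReal (Real.exp (l * -(S.indicator 1 y - p))) :=
  (Real.measurable_exp.comp
    (((measurable_one.indicator hS).sub_const p).neg.const_mul l)).ennreal_ofReal

/-- Markov's inequality: the last `k` generations contribute a factor at most `s` per individual of
generation `m`, wherever it is, and the first `m` generations then contribute only through their
size. -/
theorem IsBRW.measure_le (h : IsBRW P q μ N X) {S : Set ℝ} (hS : MeasurableSet S) {p l s : ℝ}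
    (hp : 0 < p) (hl : 0 ≤ l) {m k : ℕ}
    (hs : ∀ x, (branchingOp q μ)^[k]
      (fun y => ENNReal.ofReal (Real.exp (l * (S.indicator 1 y - p)))) x ≤ ENNReal.ofReal s) :
    P {ω | p ≤ empirical (fun u => N u ω) (fun u => X u ω) (m + k) S} ≤
      (offspringPgf q)^[m] (ENNReal.ofReal s) := by
  set f : ℝ → ℝ≥0∞ := fun y => ENNReal.ofReal (Real.exp (l * (S.indicator 1 y - p))) with hf
  have hfm : Measurable f := measurable_ofReal_exp hS l p
  have hprod := measurable_prod_position (m + k) hfm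
  calc P {ω | p ≤ empirical (fun u => N u ω) (fun u => X u ω) (m + k) S}
      ≤ P ((fun ω => ((fun u => N u ω), (fun u => X u ω))) ⁻¹'
          {p | 1 ≤ ∏ v ∈ generationFinset p.1 (m + k), f (position p.2 v)}) :=
        measure_mono fun ω hω => one_le_prod_exp hl hp hω
    _ = canonicalLaw q μ {p | 1 ≤ ∏ v ∈ generationFinset p.1 (m + k), f (position p.2 v)} := by
        rw [← h.map_eq, Measure.map_apply h.measurable_pair (measurableSet_le measurable_const hprod)]
    _ ≤ ∫⁻ p, ∏ v ∈ generationFinset p.1 (m + k), f (position p.2 v) ∂(canonicalLaw q μ) := by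
        simpa using mul_meas_ge_le_lintegral hprod 1
    _ = (branchingOp q μ)^[m] ((branchingOp q μ)^[k] f) 0 := by
        rw [lintegral_prod_generation hfm, Function.iterate_add_apply]
    _ ≤ _ := iterate_branchingOp_le hs m 0

/-- On the spine event generation `m` is one particle in `I`, so the spine event together with
failure has probability at most `s` times that of the spine event. The additive form avoids
subtraction in `ℝ≥0∞`. -/
theorem IsBRW.le_measure (h : IsBRW P q μ N X) {S I : Set ℝ} (hS : MeasurableSet S)
    (hI : MeasurableSet I) {p l s : ℝ} (hl : 0 ≤ l) {m k : ℕ}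
    (hs : ∀ x ∈ I, (branchingOp q μ)^[k]
      (fun y => ENNReal.ofReal (Real.exp (l * -(S.indicator 1 y - p)))) x ≤ ENNReal.ofReal s) :
    q 1 ^ m * walkLaw μ m I ≤
      P {ω | p ≤ empirical (fun u => N u ω) (fun u => X u ω) (m + k) S} +
        ENNReal.ofReal s * (q 1 ^ m * walkLaw μ m I) := by
  set f : ℝ → ℝ≥0∞ := fun y => ENNReal.ofReal (Real.exp (l * -(S.indicator 1 y - p))) with hf
  have hfm : Measurable f := measurable_ofReal_exp_neg hS l p
  have hprod := measurable_prod_position (m + k) hfm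
  have hG := measurableSet_spineEvent m hI
  set G := spineEvent m I with hG_def
  set T : Ω → (List ℕ → ℕ) × (List ℕ → ℝ) := fun ω => ((fun u => N u ω), (fun u => X u ω)) with hT
  have hle : MeasurableSet {p : (List ℕ → ℕ) × (List ℕ → ℝ) |
      1 ≤ ∏ v ∈ generationFinset p.1 (m + k), f (position p.2 v)} :=
    measurableSet_le measurable_const hprod
  have hind : Measurable (G.indicator (1 : (List ℕ → ℕ) × (List ℕ → ℝ) → ℝ≥0∞)) :=
    measurable_one.indicator hG
  rw [← canonicalLaw_spineEvent m hI]
  calc canonicalLaw q μ G = P (T ⁻¹' G) := by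
        rw [← h.map_eq, Measure.map_apply h.measurable_pair hG]
    _ ≤ P ({ω | p ≤ empirical (fun u => N u ω) (fun u => X u ω) (m + k) S} ∪ T ⁻¹' (G ∩
          {p | 1 ≤ ∏ v ∈ generationFinset p.1 (m + k), f (position p.2 v)})) := by
        refine measure_mono fun ω hω => ?_
        by_cases hE : p ≤ empirical (fun u => N u ω) (fun u => X u ω) (m + k) S
        · exact Or.inl hE
        · exact Or.inr ⟨hω, one_le_prod_exp_neg hl (not_le.1 hE)⟩
    _ ≤ _ := measure_union_le _ _
    _ ≤ _ := by
        gcongr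
        calc P (T ⁻¹' (G ∩ {p | 1 ≤ ∏ v ∈ generationFinset p.1 (m + k), f (position p.2 v)}))
            = canonicalLaw q μ
              (G ∩ {p | 1 ≤ ∏ v ∈ generationFinset p.1 (m + k), f (position p.2 v)}) := by
              rw [← h.map_eq, Measure.map_apply h.measurable_pair (hG.inter hle)]
          _ = ∫⁻ p, (G ∩ {p | 1 ≤ ∏ v ∈ generationFinset p.1 (m + k),
                f (position p.2 v)}).indicator 1 p ∂(canonicalLaw q μ) :=
              (lintegral_indicator_one (hG.inter hle)).symm
          _ ≤ ∫⁻ p, G.indicator 1 (p.1, p.2) * ∏ v ∈ generationFinset p.1 (m + k),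
                f (position p.2 v) ∂(canonicalLaw q μ) := by
              refine lintegral_mono fun p => ?_
              by_cases hp : p ∈ G ∩ {p | 1 ≤ ∏ v ∈ generationFinset p.1 (m + k),
                f (position p.2 v)}
              · rw [Set.indicator_of_mem hp, Set.indicator_of_mem hp.1]
                simpa using hp.2
              · rw [Set.indicator_of_notMem hp]
                exact zero_le
          _ = ∫⁻ p, G.indicator 1 (p.1, p.2) * ∏ v ∈ generationFinset p.1 m,
                (branchingOp q μ)^[k] f (position p.2 v) ∂(canonicalLaw q μ) :=
              lintegral_prod_generation_add (F := fun N X => G.indicator 1 (N, X)) hind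
                (dependsUpTo_spineEvent m I) hfm k
          _ ≤ ∫⁻ p, ENNReal.ofReal s * G.indicator 1 p ∂(canonicalLaw q μ) := by
              refine lintegral_mono fun p => ?_
              by_cases hp : p ∈ G
              · rw [Set.indicator_of_mem (show (p.1, p.2) ∈ G from hp),
                  generationFinset_of_spine hp.1, Finset.prod_singleton]
                simpa using hs _ hp.2
              · simp [Set.indicator_of_notMem (show (p.1, p.2) ∉ G from hp)]
          _ = ENNReal.ofReal s * canonicalLaw q μ G := by
              rw [lintegral_const_mul _ hind, lintegral_indicator_one hG]

end Bounds

end BRW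

/-! ### Uniform convergence of distribution functions. -/

/-- **Pólya's theorem**: pointwise convergence of distribution functions to a continuous one is
uniform. -/
theorem uniform_real_Iic_of_tendsto {W : ℕ → Measure ℝ} [∀ k, IsProbabilityMeasure (W k)]
    {ν : Measure ℝ} [IsProbabilityMeasure ν] [NullSingletonClass ν]
    (h : ∀ t, Tendsto (fun k => (W k).real (Set.Iic t)) atTop (𝓝 (ν.real (Set.Iic t))))
    {ε : ℝ} (hε : 0 < ε) :
    ∃ K, ∀ k ≥ K, ∀ t, |(W k).real (Set.Iic t) - ν.real (Set.Iic t)| ≤ ε := by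
  have hmono : ∀ (ρ : Measure ℝ) [IsProbabilityMeasure ρ] {s t : ℝ}, s ≤ t →
      ρ.real (Set.Iic s) ≤ ρ.real (Set.Iic t) := fun ρ _ s t hst =>
    measureReal_mono (Set.Iic_subset_Iic.2 hst)
  have hcont : Continuous fun t => ν.real (Set.Iic t) := by
    refine continuous_iff_continuousAt.2 fun t => ?_
    refine (ENNReal.tendsto_toReal (measure_ne_top ν _)).comp
      (tendsto_measure_of_ae_tendsto_indicator (𝓝 t) measurableSet_Iic (fun _ => measurableSet_Iic)
        MeasurableSet.univ (measure_ne_top ν _) (Eventually.of_forall fun _ => Set.subset_univ _) ?_)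
    have h0 : ∀ᵐ x ∂ν, x ≠ t := by simp [ae_iff]
    filter_upwards [h0] with x hx
    rcases lt_or_gt_of_ne hx with hlt | hgt
    · filter_upwards [lt_mem_nhds hlt] with i hi
      simp [hi.le, hlt.le]
    · filter_upwards [gt_mem_nhds hgt] with i hi
      simp [not_le.2 hi, not_le.2 hgt]
  have hbot : Tendsto (fun t => ν.real (Set.Iic t)) atBot (𝓝 0) :=
    (tendsto_cdf_atBot ν).congr fun t => cdf_eq_real ν t
  have htop : Tendsto (fun t => ν.real (Set.Iic t)) atTop (𝓝 1) :=
    (tendsto_cdf_atTop ν).congr fun t => cdf_eq_real ν t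
  have hev : ∀ t, ∀ᶠ k in atTop, |(W k).real (Set.Iic t) - ν.real (Set.Iic t)| < ε / 3 := fun t => by
    have := (h t).eventually (Metric.ball_mem_nhds _ (show 0 < ε / 3 by positivity))
    simpa [Real.dist_eq] using this
  obtain ⟨R₁, hR₁⟩ := (hbot.eventually (gt_mem_nhds (show 0 < ε / 3 by positivity))).exists
  obtain ⟨R₂, hR₂⟩ := (htop.eventually (lt_mem_nhds (show 1 - ε / 3 < 1 by linarith))).exists
  -- Monotonicity sandwiches both distribution functions on a short interval between their values at
  -- its ends; compactness of `[R₁, R₂]` glues these local bounds, and the tails are handled apart.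
  have hloc : ∀ t ∈ Set.Icc R₁ R₂, ∃ U ∈ 𝓝[Set.Icc R₁ R₂] t, ∀ᶠ k in atTop, ∀ u ∈ U,
      |(W k).real (Set.Iic u) - ν.real (Set.Iic u)| ≤ ε := by
    intro t _
    have hc := hcont.continuousAt (x := t) |>.eventually
      (Metric.ball_mem_nhds _ (show 0 < ε / 3 by positivity))
    obtain ⟨δ, hδ, hball⟩ := Metric.eventually_nhds_iff_ball.1 hc
    have ha := hball (t - δ / 2) (by
      rw [Metric.mem_ball, Real.dist_eq, abs_lt]; constructor <;> linarith)
    have hb := hball (t + δ / 2) (by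
      rw [Metric.mem_ball, Real.dist_eq, abs_lt]; constructor <;> linarith)
    rw [Real.dist_eq, abs_lt] at ha hb
    refine ⟨Set.Ioo (t - δ / 2) (t + δ / 2), mem_nhdsWithin_of_mem_nhds
      (Ioo_mem_nhds (by linarith) (by linarith)), ?_⟩
    filter_upwards [hev (t - δ / 2), hev (t + δ / 2)] with k h1 h2 u hu
    rw [abs_lt] at h1 h2
    have m1 := hmono (W k) hu.1.le
    have m2 := hmono (W k) hu.2.le
    have m3 := hmono ν hu.1.le
    have m4 := hmono ν hu.2.le
    rw [abs_le]
    constructor <;> linarith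
  have hmid : ∀ᶠ k in atTop, ∀ u ∈ Set.Icc R₁ R₂,
      |(W k).real (Set.Iic u) - ν.real (Set.Iic u)| ≤ ε := by
    refine (isCompact_Icc (a := R₁) (b := R₂)).induction_on
      (p := fun s => ∀ᶠ k in atTop, ∀ u ∈ s, |(W k).real (Set.Iic u) - ν.real (Set.Iic u)| ≤ ε)
      ?_ ?_ ?_ hloc
    · simp
    · intro s t hst ht
      filter_upwards [ht] with k hk u hu using hk u (hst hu)
    · intro s t hs ht
      filter_upwards [hs, ht] with k h1 h2 u hu using hu.elim (h1 u) (h2 u)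
  refine eventually_atTop.1 ?_
  filter_upwards [hmid, hev R₁, hev R₂] with k h1 h2 h3 u
  rw [abs_lt] at h2 h3
  by_cases hu1 : u < R₁
  · have m1 := hmono (W k) hu1.le
    have m2 := hmono ν hu1.le
    have m3 : 0 ≤ (W k).real (Set.Iic u) := measureReal_nonneg
    have m4 : 0 ≤ ν.real (Set.Iic u) := measureReal_nonneg
    rw [abs_le]
    constructor <;> linarith
  by_cases hu2 : R₂ < u
  · have m1 := hmono (W k) hu2.le
    have m2 := hmono ν hu2.le
    have m3 : (W k).real (Set.Iic u) ≤ 1 := measureReal_le_one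
    have m4 : ν.real (Set.Iic u) ≤ 1 := measureReal_le_one
    rw [abs_le]
    constructor <;> linarith
  · exact h1 u ⟨not_lt.1 hu1, not_lt.1 hu2⟩

/-! ### Sets of the algebra under affine maps. -/

section HalfLineAlgebra

/-- The span of the constants and of the indicators of the half-lines `(-∞, t]`. -/
def halfLineSpan : Submodule ℝ (ℝ → ℝ) :=
  Submodule.span ℝ (insert 1 (Set.range fun t : ℝ => (Set.Iic t).indicator (1 : ℝ → ℝ)))

theorem one_mem_halfLineSpan : (1 : ℝ → ℝ) ∈ halfLineSpan :=
  Submodule.subset_span (Set.mem_insert _ _)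

theorem mul_mem_halfLineSpan {f g : ℝ → ℝ} (hf : f ∈ halfLineSpan) (hg : g ∈ halfLineSpan) :
    f * g ∈ halfLineSpan := by
  have h : halfLineSpan * halfLineSpan ≤ halfLineSpan := by
    unfold halfLineSpan
    rw [Submodule.span_mul_span]
    refine Submodule.span_le.2 ?_
    rintro _ ⟨a, ha, b, hb, rfl⟩
    rcases ha with rfl | ⟨s, rfl⟩
    · simpa using Submodule.subset_span hb
    rcases hb with rfl | ⟨t, rfl⟩
    · show _ * _ ∈ _
      rw [mul_one]
      exact Submodule.subset_span (Set.mem_insert_of_mem _ (Set.mem_range_self s))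
    · refine Submodule.subset_span (Set.mem_insert_of_mem _ ⟨min s t, ?_⟩)
      simp only [← Set.inter_indicator_one, Set.Iic_inter_Iic]
  exact h (Submodule.mul_mem_mul hf hg)

/-- Half-lines are stable under intersection, so the span is closed under products and hence
contains indicators of unions. Estimates stable under linear combinations then need only half-lines.
-/
theorem indicator_mem_halfLineSpan {A : Set ℝ} (hA : A ∈ halfLineAlgebra) :
    A.indicator (1 : ℝ → ℝ) ∈ halfLineSpan := by
  induction hA with
  | base s hs =>
    obtain ⟨t, rfl⟩ := hs
    exact Submodule.subset_span (Set.mem_insert_of_mem _ ⟨t, rfl⟩)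
  | empty => rw [Set.indicator_empty']; exact Submodule.zero_mem _
  | compl s _ ih =>
    rw [Set.indicator_compl]
    exact Submodule.sub_mem _ one_mem_halfLineSpan ih
  | union s t _ _ ihs iht =>
    rw [eq_sub_of_add_eq (Set.indicator_union_add_inter (1 : ℝ → ℝ) s t), Set.inter_indicator_one]
    exact Submodule.sub_mem _ (Submodule.add_mem _ ihs iht) (mul_mem_halfLineSpan ihs iht)

theorem measurableSet_of_mem_halfLineAlgebra {A : Set ℝ} (hA : A ∈ halfLineAlgebra) :
    MeasurableSet A := by
  induction hA with
  | base s hs => obtain ⟨t, rfl⟩ := hs; exact measurableSet_Iic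
  | empty => exact MeasurableSet.empty
  | compl s _ ih => exact ih.compl
  | union s t _ _ ihs iht => exact ihs.union iht

theorem finite_frontier_of_mem_halfLineAlgebra {A : Set ℝ} (hA : A ∈ halfLineAlgebra) :
    (frontier A).Finite := by
  induction hA with
  | base s hs => obtain ⟨t, rfl⟩ := hs; rw [frontier_Iic]; exact Set.finite_singleton t
  | empty => simp
  | compl s _ ih => rwa [frontier_compl]
  | union s t _ _ ihs iht =>
    refine (ihs.union iht).subset ((frontier_union_subset s t).trans ?_)
    exact Set.union_subset_union Set.inter_subset_left Set.inter_subset_right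

theorem measurable_and_bounded_of_mem_halfLineSpan {f : ℝ → ℝ} (hf : f ∈ halfLineSpan) :
    Measurable f ∧ ∃ C, ∀ x, |f x| ≤ C := by
  induction hf using Submodule.span_induction with
  | mem f hf =>
    rcases hf with rfl | ⟨t, rfl⟩
    · exact ⟨measurable_one, 1, fun x => by simp⟩
    · refine ⟨measurable_one.indicator measurableSet_Iic, 1, fun x => ?_⟩
      by_cases hx : x ∈ Set.Iic t <;> simp [hx]
  | zero => exact ⟨measurable_zero, 0, fun x => by simp⟩
  | add f g _ _ hf hg =>
    obtain ⟨hf, C, hC⟩ := hf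
    obtain ⟨hg, D, hD⟩ := hg
    exact ⟨hf.add hg, C + D, fun x => (abs_add_le _ _).trans (add_le_add (hC x) (hD x))⟩
  | smul c f _ hf =>
    obtain ⟨hf, C, hC⟩ := hf
    refine ⟨hf.const_smul c, |c| * C, fun x => ?_⟩
    rw [Pi.smul_apply, smul_eq_mul, abs_mul]
    exact mul_le_mul_of_nonneg_left (hC x) (abs_nonneg c)

theorem integrable_affine_of_mem_halfLineSpan {f : ℝ → ℝ} (hf : f ∈ halfLineSpan) (ρ : Measure ℝ)
    [IsProbabilityMeasure ρ] (x a : ℝ) : Integrable (fun s => f (x + a * s)) ρ := by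
  obtain ⟨hm, C, hC⟩ := measurable_and_bounded_of_mem_halfLineSpan hf
  exact Integrable.of_bound (hm.comp ((measurable_id.const_mul a).const_add x)).aestronglyMeasurable
    C (ae_of_all _ fun s => hC _)

/-- Uniform convergence over all increasing affine changes of variables. -/
theorem uniform_integral_affine {W : ℕ → Measure ℝ} [∀ k, IsProbabilityMeasure (W k)]
    {ν : Measure ℝ} [IsProbabilityMeasure ν] [NullSingletonClass ν]
    (h : ∀ t, Tendsto (fun k => (W k).real (Set.Iic t)) atTop (𝓝 (ν.real (Set.Iic t))))
    {f : ℝ → ℝ} (hf : f ∈ halfLineSpan) :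
    ∀ ε > 0, ∃ K, ∀ k ≥ K, ∀ x a : ℝ, 0 < a →
      |∫ s, f (x + a * s) ∂(W k) - ∫ s, f (x + a * s) ∂ν| ≤ ε := by
  induction hf using Submodule.span_induction with
  | mem f hf =>
    intro ε hε
    rcases hf with rfl | ⟨t, rfl⟩
    · exact ⟨0, fun k _ x a _ => by simp [hε.le]⟩
    · obtain ⟨K, hK⟩ := uniform_real_Iic_of_tendsto h hε
      refine ⟨K, fun k hk x a ha => ?_⟩
      -- As `a > 0`, the affine preimage of a half-line is a half-line, so uniformity in `t` gives
      -- uniformity in `(x, a)`.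
      have key : ∀ (ρ : Measure ℝ), ∫ s, (Set.Iic t).indicator (1 : ℝ → ℝ) (x + a * s) ∂ρ =
          ρ.real (Set.Iic ((t - x) / a)) := by
        intro ρ
        rw [← integral_indicator_one measurableSet_Iic]
        refine integral_congr_ae (ae_of_all _ fun s => ?_)
        have : x + a * s ≤ t ↔ s ≤ (t - x) / a := by
          rw [le_div_iff₀ ha]
          constructor <;> intro <;> linarith
        simp only [Set.indicator_apply, Set.mem_Iic, this, Pi.one_apply]
      rw [key, key]
      exact hK k hk _
  | zero => exact fun ε hε => ⟨0, fun k _ x a _ => by simp [hε.le]⟩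
  | add f g hf hg ihf ihg =>
    intro ε hε
    obtain ⟨K, hK⟩ := ihf (ε / 2) (by positivity)
    obtain ⟨L, hL⟩ := ihg (ε / 2) (by positivity)
    refine ⟨max K L, fun k hk x a ha => ?_⟩
    simp only [Pi.add_apply]
    rw [integral_add (integrable_affine_of_mem_halfLineSpan hf _ x a)
        (integrable_affine_of_mem_halfLineSpan hg _ x a),
      integral_add (integrable_affine_of_mem_halfLineSpan hf _ x a)
        (integrable_affine_of_mem_halfLineSpan hg _ x a)]
    have h1 := abs_le.1 (hK k ((le_max_left _ _).trans hk) x a ha)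
    have h2 := abs_le.1 (hL k ((le_max_right _ _).trans hk) x a ha)
    rw [abs_le]
    constructor <;> linarith
  | smul c f _ ih =>
    intro ε hε
    obtain ⟨K, hK⟩ := ih (ε / (|c| + 1)) (by positivity)
    refine ⟨K, fun k hk x a ha => ?_⟩
    simp only [Pi.smul_apply, smul_eq_mul]
    rw [integral_const_mul, integral_const_mul, ← mul_sub, abs_mul]
    have h1 := hK k hk x a ha
    rw [le_div_iff₀ (by positivity)] at h1
    nlinarith [abs_nonneg c, abs_nonneg (∫ s, f (x + a * s) ∂(W k) - ∫ s, f (x + a * s) ∂ν)]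

theorem measurableSet_affine {A : Set ℝ} (hA : MeasurableSet A) (x a : ℝ) :
    MeasurableSet {s : ℝ | x + a * s ∈ A} :=
  ((measurable_id.const_mul a).const_add x) hA

theorem integral_indicator_affine {A : Set ℝ} (hA : MeasurableSet A) (ρ : Measure ℝ) (x a : ℝ) :
    ∫ s, A.indicator (1 : ℝ → ℝ) (x + a * s) ∂ρ = ρ.real {s | x + a * s ∈ A} := by
  rw [← integral_indicator_one (measurableSet_affine hA x a)]
  rfl

theorem uniform_measure_affine {W : ℕ → Measure ℝ} [∀ k, IsProbabilityMeasure (W k)]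
    {ν : Measure ℝ} [IsProbabilityMeasure ν] [NullSingletonClass ν]
    (h : ∀ t, Tendsto (fun k => (W k).real (Set.Iic t)) atTop (𝓝 (ν.real (Set.Iic t))))
    {A : Set ℝ} (hA : A ∈ halfLineAlgebra) {ε : ℝ} (hε : 0 < ε) :
    ∃ K, ∀ k ≥ K, ∀ x a : ℝ, 0 < a →
      |(W k).real {s | x + a * s ∈ A} - ν.real {s | x + a * s ∈ A}| ≤ ε := by
  simpa only [integral_indicator_affine (measurableSet_of_mem_halfLineAlgebra hA)] using
    uniform_integral_affine h (indicator_mem_halfLineSpan hA) ε hε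

/-- Unless `x + a * s` lies in the finite frontier of `A`, the indicator is locally constant in `(x,
a)`; the exceptional `s` are finitely many, hence null. -/
theorem continuousAt_measure_affine {A : Set ℝ} (hA : A ∈ halfLineAlgebra) {ν : Measure ℝ}
    [IsProbabilityMeasure ν] [NullSingletonClass ν] (x : ℝ) {a : ℝ} (ha : 0 < a) :
    ContinuousAt (fun z : ℝ × ℝ => ν.real {s | z.1 + z.2 * s ∈ A}) (x, a) := by
  have hAm := measurableSet_of_mem_halfLineAlgebra hA
  refine (ENNReal.tendsto_toReal (measure_ne_top ν _)).comp
    (tendsto_measure_of_ae_tendsto_indicator (𝓝 (x, a)) (measurableSet_affine hAm _ _)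
      (fun _ => measurableSet_affine hAm _ _) MeasurableSet.univ (measure_ne_top ν _)
      (Eventually.of_forall fun _ => Set.subset_univ _) ?_)
  have hfin : {s : ℝ | x + a * s ∈ frontier A}.Finite := by
    refine (finite_frontier_of_mem_halfLineAlgebra hA).preimage (Function.Injective.injOn ?_)
    intro s t hst
    exact mul_left_cancel₀ ha.ne' (add_left_cancel hst)
  have hae : ∀ᵐ s ∂ν, x + a * s ∉ frontier A := by
    rw [ae_iff]
    simpa using hfin.measure_zero ν
  filter_upwards [hae] with s hs
  have hcont : ContinuousAt (fun z : ℝ × ℝ => z.1 + z.2 * s) (x, a) := by fun_prop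
  by_cases hmem : x + a * s ∈ A
  · have hint : A ∈ 𝓝 (x + a * s) :=
      mem_interior_iff_mem_nhds.1 (self_sdiff_frontier A ▸ ⟨hmem, hs⟩)
    filter_upwards [hcont hint] with z hz
    exact ⟨fun _ => hmem, fun _ => hz⟩
  · have hint : Aᶜ ∈ 𝓝 (x + a * s) :=
      mem_interior_iff_mem_nhds.1 (self_sdiff_frontier Aᶜ ▸ ⟨hmem, by rwa [frontier_compl]⟩)
    filter_upwards [hcont hint] with z hz
    exact ⟨fun h => absurd h hz, fun h => absurd h hmem⟩

end HalfLineAlgebra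

namespace BRW

/-! ### Central limit theorem and scaling for the walk. -/

section NormalizedWalk

variable {μ : Measure ℝ}

/-- The law of `S_k / √k` for a walk `S` with i.i.d. steps of law `μ`. -/
noncomputable def normalizedWalkLaw (μ : Measure ℝ) (k : ℕ) : Measure ℝ :=
  (walkLaw μ k).map fun s => (√(k : ℝ))⁻¹ * s

instance [IsProbabilityMeasure μ] (k : ℕ) : IsProbabilityMeasure (normalizedWalkLaw μ k) :=
  Measure.isProbabilityMeasure_map (measurable_const_mul _).aemeasurable

instance isProbabilityMeasure_normalNu : IsProbabilityMeasure normalNu := by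
  unfold normalNu; infer_instance

instance nullSingletonClass_normalNu : NullSingletonClass normalNu :=
  nullSingletonClass_gaussianReal one_ne_zero

theorem integral_id_eq_zero_of_symm (h : μ.map (fun x => -x) = μ) : ∫ x, x ∂μ = 0 := by
  have h1 : ∫ x, x ∂(μ.map fun x => -x) = ∫ x, -x ∂μ :=
    integral_map measurable_neg.aemeasurable aestronglyMeasurable_id
  rw [h, integral_neg] at h1
  linarith

theorem tendsto_normalizedWalkLaw [IsProbabilityMeasure μ] (hμ_symm : μ.map (fun x => -x) = μ)
    (hμ_var : ∫ x, x ^ 2 ∂μ = 1) (t : ℝ) :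
    Tendsto (fun k => (normalizedWalkLaw μ k).real (Set.Iic t)) atTop
      (𝓝 (normalNu.real (Set.Iic t))) := by
  set Q : Measure (List ℕ → ℝ) := Measure.infinitePi fun _ => μ with hQ
  set Y : ℕ → (List ℕ → ℝ) → ℝ := fun j X => X (List.replicate (j + 1) 0) with hY
  have hYm : ∀ j, Measurable (Y j) := fun j => measurable_pi_apply _
  have hlaw : ∀ j, Q.map (Y j) = μ := fun j => Measure.infinitePi_map_eval (fun _ => μ) _
  have hinj : Function.Injective fun j : ℕ => List.replicate (j + 1) (0 : ℕ) := fun i j h => by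
    simpa using congrArg List.length h
  have hindep : iIndepFun Y Q :=
    (iIndepFun_infinitePi (P := fun _ : List ℕ => μ) (X := fun _ x => x)
      fun _ => measurable_id).precomp hinj
  have hident : ∀ j, IdentDistrib (Y j) (Y 0) Q Q := fun j =>
    ⟨(hYm j).aemeasurable, (hYm 0).aemeasurable, by rw [hlaw, hlaw]⟩
  have h0 : Q[Y 0] = 0 := by
    rw [← integral_id_eq_zero_of_symm hμ_symm, ← hlaw 0]
    exact (integral_map (hYm 0).aemeasurable aestronglyMeasurable_id).symm
  have h1 : Q[Y 0 ^ 2] = 1 := by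
    rw [← hμ_var]
    conv_rhs => rw [← hlaw 0]
    exact (integral_map (f := fun x : ℝ => x ^ 2) (hYm 0).aemeasurable (by fun_prop)).symm
  have hgauss : HasLaw (id : ℝ → ℝ) (gaussianReal 0 1) (gaussianReal 0 1) :=
    ⟨aemeasurable_id, Measure.map_id⟩
  have hclt := (tendstoInDistribution_inv_sqrt_mul_sum hgauss h0 h1 hindep hident).tendsto
  have hport := ProbabilityMeasure.tendsto_measure_of_null_frontier_of_tendsto' hclt
    (E := Set.Iic t) (by
      rw [frontier_Iic]
      show (gaussianReal 0 1).map id {t} = 0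
      rw [Measure.map_id]
      exact measure_singleton (μ := normalNu) t)
  have hreal := (ENNReal.tendsto_toReal (by
    show (gaussianReal 0 1).map id (Set.Iic t) ≠ ∞
    rw [Measure.map_id]
    exact measure_ne_top normalNu _)).comp hport
  have hlim : (normalNu.real (Set.Iic t)) = ((gaussianReal 0 1).map id (Set.Iic t)).toReal := by
    rw [Measure.map_id]; rfl
  rw [hlim]
  refine hreal.congr fun k => ?_
  have hmap : normalizedWalkLaw μ k =
      Q.map (fun ω => (√(k : ℝ))⁻¹ * ∑ j ∈ Finset.range k, Y j ω) := by
    rw [normalizedWalkLaw, ← map_position_replicate,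
      Measure.map_map (measurable_const_mul _) (measurable_position _)]
    congr 1
    funext X
    simp only [Function.comp_apply, position_replicate, hY]
  rw [hmap]
  rfl

/-- Dividing `x + s` by `√n` turns the starting point and the remaining time into the two parameters
of an affine map acting on `s / √k`. -/
theorem walkLaw_real_smul {A : Set ℝ} (hA : MeasurableSet A) {n k : ℕ} (hn : 0 < n) (hk : 0 < k)
    (x : ℝ) : (walkLaw μ k).real {s | x + s ∈ √(n : ℝ) • A} =
      (normalizedWalkLaw μ k).real {s | x / √(n : ℝ) + √((k : ℝ) / n) * s ∈ A} := by
  have hn' : √(n : ℝ) ≠ 0 := (Real.sqrt_pos.2 (by exact_mod_cast hn)).ne'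
  have hk' : √(k : ℝ) ≠ 0 := (Real.sqrt_pos.2 (by exact_mod_cast hk)).ne'
  rw [normalizedWalkLaw, map_measureReal_apply (measurable_const_mul _)
    (measurableSet_affine hA _ _)]
  congr 1
  ext s
  simp only [Set.mem_preimage, Set.mem_ofPred_eq]
  rw [Set.mem_smul_set_iff_inv_smul_mem₀ hn', smul_eq_mul, Real.sqrt_div k.cast_nonneg]
  have : (√(n : ℝ))⁻¹ * (x + s) = x / √(n : ℝ) + √(k : ℝ) / √(n : ℝ) * ((√(k : ℝ))⁻¹ * s) := by
    field_simp
  rw [this]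

theorem integral_indicator_sub_walkLaw [IsProbabilityMeasure μ] {A : Set ℝ} (hA : MeasurableSet A) {n k : ℕ} (hn : 0 < n)
    (hk : 0 < k) (x p : ℝ) :
    ∫ s, ((√(n : ℝ) • A).indicator (1 : ℝ → ℝ) (x + s) - p) ∂(walkLaw μ k) =
      (normalizedWalkLaw μ k).real {s | x / √(n : ℝ) + √((k : ℝ) / n) * s ∈ A} - p := by
  have hn' : √(n : ℝ) ≠ 0 := (Real.sqrt_pos.2 (by exact_mod_cast hn)).ne'
  have hS : MeasurableSet (√(n : ℝ) • A) := hA.const_smul₀ _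
  have h1 : Integrable (fun s => (√(n : ℝ) • A).indicator (1 : ℝ → ℝ) (x + s)) (walkLaw μ k) :=
    Integrable.of_bound ((measurable_one.indicator hS).comp
      (measurable_const_add x)).aestronglyMeasurable 1 (ae_of_all _ fun s => by
        by_cases h : x + s ∈ √(n : ℝ) • A <;> simp [h])
  rw [integral_sub h1 (integrable_const p), ← walkLaw_real_smul hA hn hk]
  have h2 := integral_indicator_affine hS (walkLaw μ k) x 1
  simp only [one_mul] at h2
  rw [h2]
  simp

end NormalizedWalk

end BRW

/-! ### What the rate functions say about Gaussian masses. -/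

section Rates

theorem image_sub_div_eq (A : Set ℝ) (x : ℝ) {a : ℝ} (ha : a ≠ 0) :
    (fun u => (u - x) / a) '' A = {s | x + a * s ∈ A} := by
  ext s
  constructor
  · rintro ⟨u, hu, rfl⟩
    have : x + a * ((u - x) / a) = u := by field_simp; ring
    simpa only [Set.mem_ofPred_eq, this] using hu
  · intro hs
    exact ⟨_, hs, by field_simp; ring⟩

theorem bddAbove_range_normalNu_real (B : ℝ → Set ℝ) :
    BddAbove (Set.range fun x => normalNu.real (B x)) :=
  ⟨1, by rintro _ ⟨x, rfl⟩; exact measureReal_le_one⟩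

theorem rateJ_nonneg (A : Set ℝ) (p : ℝ) : 0 ≤ rateJ A p :=
  Real.sInf_nonneg fun _ hy => hy.1.1

theorem rateJ_le_one (A : Set ℝ) (p : ℝ) : rateJ A p ≤ 1 := by
  unfold rateJ
  rcases Set.eq_empty_or_nonempty {y | y ∈ Set.Icc (0 : ℝ) 1 ∧
    p ≤ ⨆ x : ℝ, normalNu.real ((fun a => (a - x) / √(1 - y)) '' A)} with h | ⟨y, hy⟩
  · rw [h, Real.sInf_empty]; exact zero_le_one
  · exact (csInf_le ⟨0, fun _ h => h.1.1⟩ hy).trans hy.1.2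

theorem normalNu_affine_lt_of_lt_rateJ {A : Set ℝ} {p y : ℝ} (hy0 : 0 ≤ y) (hy1 : y < 1)
    (hy : y < rateJ A p) (x : ℝ) : normalNu.real {s | x + √(1 - y) * s ∈ A} < p := by
  have hnot : y ∉ {y | y ∈ Set.Icc (0 : ℝ) 1 ∧
      p ≤ ⨆ x : ℝ, normalNu.real ((fun a => (a - x) / √(1 - y)) '' A)} :=
    notMem_of_lt_csInf hy ⟨0, fun _ h => h.1.1⟩
  have hlt : ⨆ x : ℝ, normalNu.real ((fun a => (a - x) / √(1 - y)) '' A) < p :=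
    not_le.1 fun h => hnot ⟨⟨hy0, hy1.le⟩, h⟩
  rw [← image_sub_div_eq A x (Real.sqrt_pos.2 (sub_pos.2 hy1)).ne']
  exact (le_ciSup (bddAbove_range_normalNu_real fun x => (fun a => (a - x) / √(1 - y)) '' A)
    x).trans_lt hlt

theorem normalNu_translate_lt_of_rateI_eq_top {A : Set ℝ} {p : ℝ} (h : rateI A p = ⊤) (x : ℝ) :
    normalNu.real {s | x + s ∈ A} < p := by
  by_contra! hle
  have himg : (fun a => a - x) '' A = {s | x + s ∈ A} := by
    simpa using image_sub_div_eq A x one_ne_zero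
  have := sInf_eq_top.1 h (ENNReal.ofReal |x|) ⟨x, rfl, by rwa [himg]⟩
  exact ENNReal.ofReal_ne_top this

theorem nonempty_interior_of_mem_halfLineAlgebra {A : Set ℝ} (hA : A ∈ halfLineAlgebra)
    (hpos : 0 < normalNu.real A) : (interior A).Nonempty := by
  by_contra! h
  have hsub : A ⊆ frontier A := by
    rw [← Set.sdiff_eq_empty, self_sdiff_frontier, h]
  have h0 : normalNu A = 0 :=
    measure_mono_null hsub ((finite_frontier_of_mem_halfLineAlgebra hA).measure_zero _)
  rw [measureReal_def, h0] at hpos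
  simp at hpos

/-- Zooming in at an interior point `c` of `A`: as `a → 0`, `c + a * s` enters `A` for every `s`, so
the mass tends to `1`. The scale `a` corresponds to `y = 1 - a ^ 2`. -/
theorem exists_le_normalNu_affine {A : Set ℝ} (hA : A ∈ halfLineAlgebra)
    (hpos : 0 < normalNu.real A) {p : ℝ} (hp : p < 1) :
    ∃ y, 0 ≤ y ∧ y < 1 ∧ ∃ x, p ≤ normalNu.real {s | x + √(1 - y) * s ∈ A} := by
  obtain ⟨c, hc⟩ := nonempty_interior_of_mem_halfLineAlgebra hA hpos
  have hAm := measurableSet_of_mem_halfLineAlgebra hA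
  have htend : Tendsto (fun a : ℝ => normalNu.real {s | c + a * s ∈ A}) (𝓝[>] 0) (𝓝 1) := by
    have := (ENNReal.tendsto_toReal (measure_ne_top normalNu Set.univ)).comp
      (tendsto_measure_of_ae_tendsto_indicator_of_isFiniteMeasure (𝓝[>] (0 : ℝ)) MeasurableSet.univ
        (fun a => measurableSet_affine hAm c a) (ae_of_all normalNu fun s => ?_))
    · simpa [Function.comp_def, measureReal_def] using this
    · have hcont : Tendsto (fun a : ℝ => c + a * s) (𝓝[>] 0) (𝓝 c) := by
        have : ContinuousAt (fun a : ℝ => c + a * s) 0 := by fun_prop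
        simpa using this.tendsto.mono_left nhdsWithin_le_nhds
      filter_upwards [hcont (mem_interior_iff_mem_nhds.1 hc)] with a ha
      exact ⟨fun _ => trivial, fun _ => ha⟩
  obtain ⟨a, ha, ha0, ha1⟩ := ((htend.eventually (lt_mem_nhds hp)).and
    (Ioo_mem_nhdsGT (zero_lt_one' ℝ))).exists
  refine ⟨1 - a ^ 2, by nlinarith, by nlinarith, c, ?_⟩
  rw [sub_sub_cancel, Real.sqrt_sq ha0.le]
  exact ha.le

theorem exists_of_rateJ_lt {A : Set ℝ} (hA : A ∈ halfLineAlgebra) (hpos : 0 < normalNu.real A)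
    {p b : ℝ} (hp0 : 0 < p) (hp1 : p < 1) (hb : rateJ A p < b) :
    ∃ y, 0 ≤ y ∧ y < 1 ∧ y < b ∧ p ≤ ⨆ x : ℝ, normalNu.real {s | x + √(1 - y) * s ∈ A} := by
  have himg : ∀ y < (1 : ℝ), (⨆ x : ℝ, normalNu.real ((fun a => (a - x) / √(1 - y)) '' A)) =
      ⨆ x : ℝ, normalNu.real {s | x + √(1 - y) * s ∈ A} := fun y hy =>
    iSup_congr fun x => by rw [image_sub_div_eq A x (Real.sqrt_pos.2 (sub_pos.2 hy)).ne']
  have hne : {y | y ∈ Set.Icc (0 : ℝ) 1 ∧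
      p ≤ ⨆ x : ℝ, normalNu.real ((fun a => (a - x) / √(1 - y)) '' A)}.Nonempty := by
    obtain ⟨y, hy0, hy1, x, hx⟩ := exists_le_normalNu_affine hA hpos hp1
    refine ⟨y, ⟨hy0, hy1.le⟩, ?_⟩
    rw [himg y hy1]
    exact hx.trans (le_ciSup
      (bddAbove_range_normalNu_real fun x => {s | x + √(1 - y) * s ∈ A}) x)
  obtain ⟨y, ⟨⟨hy0, hy1⟩, hy⟩, hyb⟩ := exists_lt_of_csInf_lt hne hb
  -- At `y = 1` the division by `√0 = 0` sends `A` into `{0}`, a null set, which `0 < p` excludes.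
  have hy1' : y < 1 := by
    refine hy1.lt_of_ne ?_
    rintro rfl
    have hzero : ∀ x : ℝ, normalNu.real ((fun a => (a - x) / √(1 - (1 : ℝ))) '' A) = 0 := by
      intro x
      have : (fun a => (a - x) / √(1 - (1 : ℝ))) '' A ⊆ {0} := by
        rintro _ ⟨a, -, rfl⟩; simp
      rw [measureReal_def, measure_mono_null this (measure_singleton 0), ENNReal.toReal_zero]
    simp only [hzero, ciSup_const] at hy
    exact absurd hy (not_le.2 hp0)
  exact ⟨y, hy0, hy1', hyb, himg y hy1' ▸ hy⟩

end Rates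

namespace BRW

/-! ### Asymptotic bounds with `⌊y n⌋` initial generations. -/

section Asymptotics

variable {Ω : Type*} [MeasurableSpace Ω] {P : Measure Ω} [IsProbabilityMeasure P]
  {q : PMF ℕ} {μ : Measure ℝ} [IsProbabilityMeasure μ] {N : List ℕ → Ω → ℕ} {X : List ℕ → Ω → ℝ}

theorem abs_indicator_sub_le (S : Set ℝ) {p : ℝ} (hp0 : 0 ≤ p) (hp1 : p ≤ 1) (x : ℝ) :
    |S.indicator (1 : ℝ → ℝ) x - p| ≤ 1 := by
  by_cases h : x ∈ S <;> simp only [h, Set.indicator_of_mem, Set.indicator_of_notMem,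
    not_false_eq_true, Pi.one_apply] <;> rw [abs_le] <;> constructor <;> linarith

theorem tendsto_floor_mul_div {y : ℝ} (hy : 0 ≤ y) :
    Tendsto (fun n : ℕ => (⌊y * n⌋₊ : ℝ) / n) atTop (𝓝 y) :=
  (tendsto_nat_floor_mul_div_atTop hy).comp tendsto_natCast_atTop_atTop

theorem floor_mul_le {y : ℝ} (hy1 : y ≤ 1) (n : ℕ) : ⌊y * n⌋₊ ≤ n := by
  refine Nat.floor_le_of_le ?_
  exact mul_le_of_le_one_left n.cast_nonneg hy1

theorem tendsto_sub_floor_mul {y : ℝ} (hy0 : 0 ≤ y) (hy1 : y < 1) :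
    Tendsto (fun n : ℕ => n - ⌊y * n⌋₊) atTop atTop := by
  refine (tendsto_natCast_atTop_iff (R := ℝ)).1 (tendsto_atTop_mono (fun n => ?_)
    (tendsto_natCast_atTop_atTop.const_mul_atTop (sub_pos.2 hy1)))
  rw [Nat.cast_sub (floor_mul_le hy1.le n)]
  have := Nat.floor_le (a := y * n) (by positivity)
  linarith

theorem tendsto_floor_mul {y : ℝ} (hy0 : 0 < y) :
    Tendsto (fun n : ℕ => ⌊y * n⌋₊) atTop atTop :=
  tendsto_nat_floor_atTop.comp (tendsto_natCast_atTop_atTop.const_mul_atTop hy0)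

theorem sqrt_sub_floor_div {y : ℝ} (hy1 : y ≤ 1) {n : ℕ} (hn : 0 < n) :
    √(((n - ⌊y * n⌋₊ : ℕ) : ℝ) / n) = √(1 - (⌊y * n⌋₊ : ℝ) / n) := by
  have : (n : ℝ) ≠ 0 := by exact_mod_cast hn.ne'
  rw [Nat.cast_sub (floor_mul_le hy1 n), sub_div, div_self this]

theorem IsBRW.eventually_le (h : IsBRW P q μ N X) (hq0 : q 0 = 0) (hq1 : q 1 < 1)
    (hq_exp : ∃ θ : ℝ, 0 < θ ∧ Summable (fun k : ℕ => (q k).toReal * Real.exp (θ * k)))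
    (hμ_symm : μ.map (fun x => -x) = μ) (hμ_var : ∫ x, x ^ 2 ∂μ = 1)
    {A : Set ℝ} (hA : A ∈ halfLineAlgebra) {p p' : ℝ} (hp0 : 0 < p) (hp1 : p ≤ 1) (hpp' : p' < p)
    {y : ℝ} (hy0 : 0 ≤ y) (hy1 : y < 1) (hy : y < rateJ A p') {r : ℝ} (hr : (q 1).toReal < r)
    (hr1 : r < 1) :
    ∃ C > 0, ∀ᶠ n : ℕ in atTop,
      P.real {ω | p ≤ empirical (fun u => N u ω) (fun u => X u ω) n (√(n : ℝ) • A)} ≤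
        C * r ^ ⌊y * n⌋₊ := by
  have hAm := measurableSet_of_mem_halfLineAlgebra hA
  -- The gap `p - p'` is shared equally: one half absorbs the error in the central limit theorem,
  -- the other remains as the Chernoff margin.
  set c := (p - p') / 2 with hc_def
  have hc : 0 < c := by simp only [hc_def]; linarith
  obtain ⟨s, hs0, hs1, hs⟩ := exists_iterate_branchingOp_exp_le (μ := μ) hq0 hq1 hq_exp hc
  obtain ⟨C, hC, hCm⟩ := exists_iterate_offspringPgf_le hq0 hr hr1 hs0 hs1
  obtain ⟨K, hK⟩ := uniform_measure_affine (tendsto_normalizedWalkLaw hμ_symm hμ_var) hA hc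
  refine ⟨C, hC, ?_⟩
  filter_upwards [eventually_gt_atTop 0,
    (tendsto_sub_floor_mul hy0 hy1).eventually (eventually_ge_atTop (max K 1))] with n hn hk
  set m := ⌊y * n⌋₊ with hm
  set k := n - m with hk_def
  have hmk : m + k = n := Nat.add_sub_cancel' (floor_mul_le hy1.le n)
  have hk0 : 0 < k := (le_max_right K 1).trans hk
  have hkK : K ≤ k := (le_max_left K 1).trans hk
  have hn' : (0 : ℝ) < n := by exact_mod_cast hn
  have ha0 : 0 < √((k : ℝ) / n) := Real.sqrt_pos.2 (by positivity)
  have hmy : (m : ℝ) / n ≤ y := by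
    rw [div_le_iff₀ hn']
    exact Nat.floor_le (by positivity)
  obtain ⟨l, hl, hbound⟩ := hs k
  have hS : MeasurableSet (√(n : ℝ) • A) := hAm.const_smul₀ _
  have hmean : ∀ x, (branchingOp q μ)^[k] (fun z => ENNReal.ofReal
      (Real.exp (l * ((√(n : ℝ) • A).indicator 1 z - p)))) x ≤ ENNReal.ofReal s := by
    intro x
    refine hbound (fun z => (√(n : ℝ) • A).indicator 1 z - p)
      ((measurable_one.indicator hS).sub_const p)
      (abs_indicator_sub_le _ hp0.le hp1) x ?_
    rw [integral_indicator_sub_walkLaw hAm hn hk0]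
    have h1 := (abs_le.1 (hK k hkK (x / √(n : ℝ)) _ ha0)).2
    have h2 := normalNu_affine_lt_of_lt_rateJ (A := A) (p := p') (y := (m : ℝ) / n) (by positivity)
      (hmy.trans_lt hy1) (hmy.trans_lt hy) (x / √(n : ℝ))
    rw [← sqrt_sub_floor_div hy1.le hn] at h2
    simp only [hc_def] at h1 ⊢
    linarith
  have hle := h.measure_le hS (m := m) (k := k) hp0 hl.le hmean
  rw [hmk] at hle
  have hr0 : 0 < r := ENNReal.toReal_nonneg.trans_lt hr
  refine ENNReal.toReal_le_of_le_ofReal (by positivity) (hle.trans (hCm m))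

/-- The condition `0 < y` gives the line about `y n` steps, so that it reaches the ball of radius `δ
√n` around `x √n` with probability bounded below. -/
theorem IsBRW.eventually_ge (h : IsBRW P q μ N X) (hq0 : q 0 = 0) (hq1 : q 1 < 1)
    (hq_exp : ∃ θ : ℝ, 0 < θ ∧ Summable (fun k : ℕ => (q k).toReal * Real.exp (θ * k)))
    (hμ_symm : μ.map (fun x => -x) = μ) (hμ_var : ∫ x, x ^ 2 ∂μ = 1)
    {A : Set ℝ} (hA : A ∈ halfLineAlgebra) {p : ℝ} (hp0 : 0 ≤ p) (hp1 : p ≤ 1)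
    {y : ℝ} (hy0 : 0 < y) (hy1 : y < 1) {x : ℝ}
    (hx : p < normalNu.real {s | x + √(1 - y) * s ∈ A}) :
    ∃ c > 0, ∀ᶠ n : ℕ in atTop, c * (q 1).toReal ^ ⌊y * n⌋₊ ≤
      P.real {ω | p ≤ empirical (fun u => N u ω) (fun u => X u ω) n (√(n : ℝ) • A)} := by
  have hAm := measurableSet_of_mem_halfLineAlgebra hA
  have hconv := tendsto_normalizedWalkLaw hμ_symm hμ_var
  -- The level `v` keeps the strict inequality valid for all starting points and scales near `(x,
  -- √(1 - y))`; half of `v - p` goes to the central limit theorem, half to the Chernoff margin.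
  obtain ⟨v, hpv, hv⟩ := exists_between hx
  set c := (v - p) / 2 with hc_def
  have hc : 0 < c := by simp only [hc_def]; linarith
  obtain ⟨s, hs0, hs1, hs⟩ := exists_iterate_branchingOp_exp_le (μ := μ) hq0 hq1 hq_exp hc
  obtain ⟨K, hK⟩ := uniform_measure_affine hconv hA hc
  obtain ⟨δ, hδ, hball⟩ := Metric.eventually_nhds_iff_ball.1
    ((continuousAt_measure_affine hA (ν := normalNu) x
      (Real.sqrt_pos.2 (sub_pos.2 hy1))).eventually (lt_mem_nhds hv))
  have hsy : 0 < √y := Real.sqrt_pos.2 hy0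
  have hmul : ∀ᶠ z : ℝ × ℝ in 𝓝 (√y, x / √y), z.1 * z.2 ∈ Metric.ball x δ := by
    have : ContinuousAt (fun z : ℝ × ℝ => z.1 * z.2) (√y, x / √y) := by fun_prop
    refine this.eventually (Metric.isOpen_ball.mem_nhds ?_)
    simp [mul_div_cancel₀ x hsy.ne', hδ]
  obtain ⟨η, hη, hball2⟩ := Metric.eventually_nhds_iff_ball.1 hmul
  -- A window for the normalized position of the line: after rescaling by `√(m / n)`, which is close
  -- to `√y`, it falls within `δ` of `x`.
  set J : Set ℝ := Set.Ioc (x / √y - η / 2) (x / √y + η / 2) with hJ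
  have hJlt : x / √y - η / 2 < x / √y + η / 2 := by linarith
  have hJpos : 0 < normalNu.real J := by
    refine ENNReal.toReal_pos (fun h0 => ?_) (measure_ne_top _ _)
    have := gaussianReal_absolutelyContinuous' 0 one_ne_zero h0
    rw [Real.volume_Ioc, ENNReal.ofReal_eq_zero] at this
    linarith
  have hJlim : ∀ᶠ m in atTop, normalNu.real J / 2 < (normalizedWalkLaw μ m).real J := by
    have hdiff : ∀ (ρ : Measure ℝ) [IsProbabilityMeasure ρ], ρ.real J =
        ρ.real (Set.Iic (x / √y + η / 2)) - ρ.real (Set.Iic (x / √y - η / 2)) := by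
      intro ρ _
      rw [hJ, ← Set.Iic_sdiff_Iic, measureReal_sdiff (Set.Iic_subset_Iic.2 hJlt.le)
        measurableSet_Iic]
    have htend : Tendsto (fun m => (normalizedWalkLaw μ m).real J) atTop
        (𝓝 (normalNu.real J)) := by
      simp only [hdiff]
      exact (hconv _).sub (hconv _)
    exact htend.eventually (lt_mem_nhds (by linarith))
  refine ⟨(1 - s) * (normalNu.real J / 2), mul_pos (sub_pos.2 hs1) (by positivity), ?_⟩
  have hfrac := tendsto_floor_mul_div hy0.le
  have hsq1 : ∀ᶠ n : ℕ in atTop, √(1 - (⌊y * n⌋₊ : ℝ) / n) ∈ Metric.ball (√(1 - y)) δ :=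
    ((Real.continuous_sqrt.tendsto _).comp (hfrac.const_sub 1)).eventually
      (Metric.ball_mem_nhds _ hδ)
  have hsq2 : ∀ᶠ n : ℕ in atTop, √((⌊y * n⌋₊ : ℝ) / n) ∈ Metric.ball (√y) η :=
    ((Real.continuous_sqrt.tendsto _).comp hfrac).eventually (Metric.ball_mem_nhds _ hη)
  filter_upwards [eventually_gt_atTop 0,
    (tendsto_sub_floor_mul hy0.le hy1).eventually (eventually_ge_atTop (max K 1)),
    (tendsto_floor_mul hy0).eventually (eventually_gt_atTop 0),
    (tendsto_floor_mul hy0).eventually hJlim, hsq1, hsq2] with n hn hk hm0 hmJ hn1 hn2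
  set m := ⌊y * n⌋₊ with hm
  set k := n - m with hk_def
  have hmk : m + k = n := Nat.add_sub_cancel' (floor_mul_le hy1.le n)
  have hk0 : 0 < k := (le_max_right K 1).trans hk
  have hkK : K ≤ k := (le_max_left K 1).trans hk
  have hn' : (0 : ℝ) < n := by exact_mod_cast hn
  have hsn : 0 < √(n : ℝ) := Real.sqrt_pos.2 hn'
  have ha0 : 0 < √((k : ℝ) / n) := Real.sqrt_pos.2 (by positivity)
  obtain ⟨l, hl, hbound⟩ := hs k
  have hS : MeasurableSet (√(n : ℝ) • A) := hAm.const_smul₀ _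
  set I : Set ℝ := √(n : ℝ) • Metric.ball x δ with hI_def
  have hI : MeasurableSet I := Metric.isOpen_ball.measurableSet.const_smul₀ _
  have hmean : ∀ z ∈ I, (branchingOp q μ)^[k] (fun z => ENNReal.ofReal
      (Real.exp (l * -((√(n : ℝ) • A).indicator 1 z - p)))) z ≤ ENNReal.ofReal s := by
    intro z hz
    refine hbound (fun z => -((√(n : ℝ) • A).indicator 1 z - p))
      ((measurable_one.indicator hS).sub_const p).neg
      (fun z => by rw [abs_neg]; exact abs_indicator_sub_le _ hp0 hp1 z) z ?_
    rw [integral_neg, integral_indicator_sub_walkLaw hAm hn hk0]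
    have hz' : z / √(n : ℝ) ∈ Metric.ball x δ := by
      rwa [hI_def, Set.mem_smul_set_iff_inv_smul_mem₀ hsn.ne', smul_eq_mul,
        ← div_eq_inv_mul] at hz
    have h1 := (abs_le.1 (hK k hkK (z / √(n : ℝ)) _ ha0)).1
    have h2 := hball (z / √(n : ℝ), √(1 - (m : ℝ) / n)) (by
      rw [← ball_prod_same]; exact ⟨hz', hn1⟩)
    simp only at h2
    rw [← sqrt_sub_floor_div hy1.le hn] at h2
    simp only [hc_def] at h1 ⊢
    linarith
  have hle := h.le_measure hS hI (m := m) (k := k) hl.le hmean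
  rw [hmk] at hle
  have hwalk : normalNu.real J / 2 ≤ (walkLaw μ m).real I := by
    refine hmJ.le.trans ?_
    have := walkLaw_real_smul (μ := μ) (Metric.isOpen_ball (x := x) (ε := δ)).measurableSet hn hm0 0
    simp only [zero_add, zero_div, Set.ofPred_mem_eq] at this
    rw [hI_def, this]
    refine measureReal_mono fun z hz => ?_
    refine hball2 (√((m : ℝ) / n), z) ?_
    rw [← ball_prod_same]
    refine ⟨hn2, ?_⟩
    rw [Metric.mem_ball, Real.dist_eq, abs_lt]
    constructor <;> linarith [hz.1, hz.2]
  have hreal := ENNReal.toReal_mono (by finiteness [q.apply_ne_top 1]) hle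
  rw [ENNReal.toReal_add (by finiteness) (by finiteness [q.apply_ne_top 1]), ENNReal.toReal_mul,
    ENNReal.toReal_mul, ENNReal.toReal_mul, ENNReal.toReal_pow, ENNReal.toReal_ofReal hs0] at hreal
  change (q 1).toReal ^ m * (walkLaw μ m).real I ≤ P.real _ +
    s * ((q 1).toReal ^ m * (walkLaw μ m).real I) at hreal
  have hpow : 0 ≤ (q 1).toReal ^ m := by positivity
  calc (1 - s) * (normalNu.real J / 2) * (q 1).toReal ^ m
      ≤ (1 - s) * (walkLaw μ m).real I * (q 1).toReal ^ m := by
        gcongr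
    _ ≤ _ := by linarith

theorem tendsto_log_mul_pow_div {y c r : ℝ} (hy : 0 ≤ y) (hc : 0 < c) (hr : 0 < r) :
    Tendsto (fun n : ℕ => 1 / (n : ℝ) * Real.log (c * r ^ ⌊y * n⌋₊)) atTop
      (𝓝 (y * Real.log r)) := by
  have h1 : Tendsto (fun n : ℕ => 1 / (n : ℝ) * Real.log c + (⌊y * n⌋₊ : ℝ) / n * Real.log r)
      atTop (𝓝 (0 * Real.log c + y * Real.log r)) :=
    (tendsto_one_div_atTop_nhds_zero_nat.mul_const _).add ((tendsto_floor_mul_div hy).mul_const _)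
  rw [zero_mul, zero_add] at h1
  refine h1.congr fun n => ?_
  rw [Real.log_mul hc.ne' (by positivity), Real.log_pow]
  ring

end Asymptotics

end BRW

/-! ### The limit. -/

theorem theorem2 {Ω : Type*} [MeasurableSpace Ω] (P : Measure Ω) [IsProbabilityMeasure P]
    (q : PMF ℕ) (μ : Measure ℝ) [IsProbabilityMeasure μ]
    (N : List ℕ → Ω → ℕ) (X : List ℕ → Ω → ℝ) (hBRW : BRW.IsBRW P q μ N X)
    (hq0 : q 0 = 0) (hq1 : 0 < q 1) (hq1_lt : q 1 < 1)
    (hq_exp : ∃ θ : ℝ, 0 < θ ∧ Summable (fun k : ℕ => (q k).toReal * Real.exp (θ * k)))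
    (hμ_symm : μ.map (fun x => -x) = μ)
    (hμ_L2 : MemLp (fun x : ℝ => x) 2 μ) (hμ_var : ∫ x, x ^ 2 ∂μ = 1)
    (A : Set ℝ) (hA : A ∈ halfLineAlgebra) (hA_ne : A.Nonempty) (hA_pos : 0 < normalNu.real A)
    (p : ℝ) (hp : p ∈ Set.Ioo (normalNu.real A) 1)
    (hI : rateI A p = ⊤) (hJ : ContinuousAt (rateJ A) p) :
    (∀ᶠ n : ℕ in atTop,
      0 < P.real {ω | p ≤ BRW.empirical (fun u => N u ω) (fun u => X u ω) n (√(n : ℝ) • A)}) ∧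
    Tendsto (fun n : ℕ => (1 / (n : ℝ)) * Real.log
        (P.real {ω | p ≤ BRW.empirical (fun u => N u ω) (fun u => X u ω) n (√(n : ℝ) • A)}))
      atTop (𝓝 (Real.log (q 1).toReal * rateJ A p)) := by
  have hp0 : 0 < p := hA_pos.trans hp.1
  have hp1 : p < 1 := hp.2
  set p₁ := (q 1).toReal with hp₁
  have hp₁0 : 0 < p₁ := ENNReal.toReal_pos hq1.ne' (q.apply_ne_top 1)
  have hp₁1 : p₁ < 1 := by
    rw [hp₁, ← ENNReal.toReal_one]
    exact (ENNReal.toReal_lt_toReal (q.apply_ne_top 1) ENNReal.one_ne_top).2 hq1_lt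
  set L := Real.log p₁ with hL
  have hL0 : L < 0 := Real.log_neg hp₁0 hp₁1
  have hlower : ∀ b > rateJ A p, ∃ y, 0 < y ∧ y < 1 ∧ y < b ∧ ∃ c > 0, ∀ᶠ n : ℕ in atTop,
      c * p₁ ^ ⌊y * n⌋₊ ≤
        P.real {ω | p ≤ BRW.empirical (fun u => N u ω) (fun u => X u ω) n (√(n : ℝ) • A)} := by
    intro b hb
    -- Continuity from the right gives a level `p' > p` that still has rate below `b`, hence a point
    -- `x` with mass strictly above `p`.
    obtain ⟨p', ⟨hp'J, hp'1⟩, hpp'⟩ := (((hJ.eventually (gt_mem_nhds hb)).and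
      (gt_mem_nhds hp1)).filter_mono nhdsWithin_le_nhds |>.and self_mem_nhdsWithin :
        ∀ᶠ p' in 𝓝[>] p, (rateJ A p' < b ∧ p' < 1) ∧ p' ∈ Set.Ioi p).exists
    have hpp' : p < p' := hpp'
    obtain ⟨y, hy0, hy1, hyb, hy⟩ := exists_of_rateJ_lt hA hA_pos (hp0.trans hpp') hp'1 hp'J
    obtain ⟨x, hx⟩ := exists_lt_of_lt_ciSup (hpp'.trans_le hy)
    -- For `y = 0` the mass is that of a translate of `A`, which `hI` keeps below `p`.
    have hy0' : 0 < y := by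
      refine hy0.lt_of_ne fun h0 => ?_
      subst h0
      have := normalNu_translate_lt_of_rateI_eq_top hI x
      simp only [sub_zero, Real.sqrt_one, one_mul] at hx
      exact lt_asymm hx this
    exact ⟨y, hy0', hy1, hyb, hBRW.eventually_ge hq0 hq1_lt hq_exp hμ_symm hμ_var hA hp0.le hp1.le
      hy0' hy1 hx⟩
  have hpos : ∀ᶠ n : ℕ in atTop,
      0 < P.real {ω | p ≤ BRW.empirical (fun u => N u ω) (fun u => X u ω) n (√(n : ℝ) • A)} := by
    obtain ⟨y, -, -, -, c, hc, hev⟩ := hlower _ (lt_add_one _)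
    filter_upwards [hev] with n hn
    exact lt_of_lt_of_le (by positivity) hn
  refine ⟨hpos, tendsto_order.2 ⟨fun b hb => ?_, fun b hb => ?_⟩⟩
  -- Dividing by `L < 0` reverses the inequality.
  · have hb' : rateJ A p < b / L := by
      rwa [lt_div_iff_of_neg hL0, mul_comm]
    obtain ⟨y, hy0, -, hyb, c, hc, hev⟩ := hlower _ hb'
    rw [lt_div_iff_of_neg hL0] at hyb
    filter_upwards [hev, (BRW.tendsto_log_mul_pow_div hy0.le hc hp₁0).eventually (lt_mem_nhds hyb)]
      with n hn hlim
    refine hlim.trans_le ?_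
    gcongr
  · rcases (rateJ_nonneg A p).eq_or_lt with h0 | h0
    · rw [← h0, mul_zero] at hb
      refine Eventually.of_forall fun n => lt_of_le_of_lt ?_ hb
      exact mul_nonpos_of_nonneg_of_nonpos (by positivity)
        (Real.log_nonpos measureReal_nonneg measureReal_le_one)
    · have hcont : ContinuousAt (fun z : ℝ => L * z) (rateJ A p) := by fun_prop
      obtain ⟨y, ⟨hyb, hy0⟩, hyJ⟩ := ((((hcont.eventually (gt_mem_nhds hb)).and
        (lt_mem_nhds h0)).filter_mono nhdsWithin_le_nhds).and self_mem_nhdsWithin :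
          ∀ᶠ y in 𝓝[<] (rateJ A p), (L * y < b ∧ 0 < y) ∧ y ∈ Set.Iio (rateJ A p)).exists
      have hyJ : y < rateJ A p := hyJ
      -- Continuity from the left gives room `p' < p` for the Chernoff margin. Below, `r` slightly
      -- above `p₁` still keeps `y * log r < b`, and `hpos` is needed because `log 0 = 0` would
      -- break the comparison of logarithms.
      obtain ⟨p', hp'J, hpp'⟩ := (((hJ.eventually (lt_mem_nhds hyJ)).filter_mono
        nhdsWithin_le_nhds).and self_mem_nhdsWithin :
          ∀ᶠ p' in 𝓝[<] p, y < rateJ A p' ∧ p' ∈ Set.Iio p).exists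
      have hcont2 : ContinuousAt (fun r : ℝ => y * Real.log r) p₁ :=
        (Real.continuousAt_log hp₁0.ne').const_mul y
      rw [mul_comm] at hyb
      obtain ⟨r, ⟨hrb, hr1⟩, hr⟩ := ((((hcont2.eventually (gt_mem_nhds hyb)).and
        (gt_mem_nhds hp₁1)).filter_mono nhdsWithin_le_nhds).and self_mem_nhdsWithin :
          ∀ᶠ r in 𝓝[>] p₁, (y * Real.log r < b ∧ r < 1) ∧ r ∈ Set.Ioi p₁).exists
      have hr : p₁ < r := hr
      obtain ⟨C, hC, hev⟩ := hBRW.eventually_le hq0 hq1_lt hq_exp hμ_symm hμ_var hA hp0 hp1.le hpp'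
        hy0.le (hyJ.trans_le (rateJ_le_one A p)) hp'J hr hr1
      filter_upwards [hev, hpos, (BRW.tendsto_log_mul_pow_div hy0.le hC
        (hp₁0.trans hr)).eventually (gt_mem_nhds hrb)] with n hn hn0 hlim
      refine lt_of_le_of_lt ?_ hlim
      gcongr
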